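/- Fix an algebraic theory $\mathrm{Type}$: a small category with finite products. A $\mathrm{Type}$-algebra is a finite-product-preserving functor $\mathrm{Type}\to\mathrm{Set}$; these form the full subcategory $\mathrm{Type}\text{-}\mathrm{Alg}\subseteq[\mathrm{Type},\mathrm{Set}]$. A schema $S$ is a small category $S_e$ with a profunctor $S_o\colon S_e^{op}\times\mathrm{Type}\to\mathrm{Set}$ such that every $S_o(s,-)$ is an algebra. Its collage $\tilde S$ is the category whose objects are those of $S_e$ and of $\mathrm{Type}$, whose morphisms within $S_e$ and within $\mathrm{Type}$ are the given ones, with $\tilde S(s,\tau)=S_o(s,\tau)$ and $\tilde S(\tau,s)=\emptyset$; let $i_S\colon\mathrm{Type}\to\tilde S$ be the inclusion. An $S$-instance is a functor $\tilde S\to\mathrm{Set}$ whose restriction along $i_S$ is an algebra; these form the full subcategory $S\text{-}\mathrm{Inst}\subseteq[\tilde S,\mathrm{Set}]$. The Yoneda embedding gives $y_S\colon\tilde S^{op}\to S\text{-}\mathrm{Inst}$. A bimodule $M\colon R\nrightarrow S$ is a functor $M\colon\tilde R^{op}\to S\text{-}\mathrm{Inst}$ with $M i_R=y_S i_S$ on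 $\mathrm{Type}^{op}$; a morphism of bimodules is a natural transformation that is the identity on $\mathrm{Type}^{op}$. Let $\Lambda_M\colon R\text{-}\mathrm{Inst}\to S\text{-}\mathrm{Inst}$ be the left Kan extension of $M$ along $y_R$, chosen so that $\Lambda_M y_R i_R=y_S i_S$ strictly and so that the comparison $M\cong\Lambda_M y_R$ is the identity on types. Let $\Gamma_M\colon S\text{-}\mathrm{Inst}\to R\text{-}\mathrm{Inst}$ be $(\Gamma_M J)(r)=S\text{-}\mathrm{Inst}(M(r),J)$, where for a type $\tau$ one identifies $S\text{-}\mathrm{Inst}(y_S(\tau),J)$ with $J(\tau)$, so that $\Gamma_M$ strictly commutes with the restrictions to $\mathrm{Type}\text{-}\mathrm{Alg}$. The horizontal bicategory $\mathcal{HH}or(\mathbb{D}ata)$ has as objects the schemas, as 1-cells the bimodules and as 2-cells the morphisms of bimodules; the composite of $M\colon R\nrightarrow S$ and $N\colon S\nrightarrow S'$ is $\Lambda_N\circ M$, and the units are the $y_S$. Let $\mathbf{LAdj}_{\mathrm{Type}}$ be the 2-category with an object $S\text{-}\mathrm{Inst}$ for each schema $S$, with 1-cells $R\to S$ the left adjoint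 functors $L\colon R\text{-}\mathrm{Inst}\to S\text{-}\mathrm{Inst}$ such that $L y_R i_R=y_S i_S$, and with 2-cells the natural transformations that restrict to the identity along $y_Ri_R$. Let $\mathbf{RAdj}_{\mathrm{Type}}$ be the 2-category with the same objects, with 1-cells $S\to R$ the right adjoint functors $G\colon S\text{-}\mathrm{Inst}\to R\text{-}\mathrm{Inst}$ that strictly commute with the restrictions to $\mathrm{Type}\text{-}\mathrm{Alg}$, and with 2-cells the natural transformations whose restrictions to $\mathrm{Type}\text{-}\mathrm{Alg}$ are identities. Write $\mathbf{RAdj}_{\mathrm{Type}}^{op}$ for the result of reversing both 1-cells and 2-cells. An adjunction $L\dashv G$ between such 1-cells is called compatible with types if whenever $f\colon y_R(\tau)\to GJ$ corresponds to $f'\colon y_S(\tau)=L y_R(\tau)\to J$, the elements of $(GJ)(\tau)=J(\tau)$ given by $f$ and $f'$ through the Yoneda lemma coincide. A pseudofunctor is a local equivalence if it induces equivalences on all hom-categories. **Proposition.** (i) The assignments $S\mapsto S\text{-}\mathrm{Inst}$, $M\mapsto\Lambda_M$, with the action on morphisms of bimodules induced by the universal property of Kan extensions and with the canonical constraints $\Lambda_{y_S}\cong\mathrm{id}$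 and $\Lambda_{\Lambda_N\circ M}\cong\Lambda_N\circ\Lambda_M$, form a pseudofunctor $\Lambda\colon\mathcal{HH}or(\mathbb{D}ata)\to\mathbf{LAdj}_{\mathrm{Type}}$, and it is a local equivalence. (ii) The assignments $S\mapsto S\text{-}\mathrm{Inst}$, $M\mapsto\Gamma_M$, with the action on morphisms of bimodules by precomposition and with constraints the mates of those of $\Lambda$ under the adjunctions $\Lambda_M\dashv\Gamma_M$, form a pseudofunctor $\Gamma\colon\mathcal{HH}or(\mathbb{D}ata)\to\mathbf{RAdj}_{\mathrm{Type}}^{op}$, and it is a local equivalence. (iii) Every 1-cell of $\mathbf{LAdj}_{\mathrm{Type}}$ has a right adjoint in $\mathbf{RAdj}_{\mathrm{Type}}$ by an adjunction compatible with types. For every choice of such adjunctions, sending $L$ to its right adjoint and 2-cells to their mates, with the constraints given by uniqueness of adjoints, is a pseudofunctor $\Psi\colon\mathbf{LAdj}_{\mathrm{Type}}\to\mathbf{RAdj}_{\mathrm{Type}}^{op}$ which is the identity on objects and an equivalence of bicategories (in particular a local equivalence), and the triangle commutes: there is an invertible pseudonatural transformation $\Psi\circ\Lambda\cong\Gamma$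 all of whose object components are identities. -/

import Mathlib

open CategoryTheory CategoryTheory.Limits Opposite

universe u

set_option linter.unusedVariables false

namespace AlgDB

/-- A database schema over the algebraic theory `T`: a small category `E` of entities
together with an algebraic profunctor `O : E ⇸ T`, that is, a functor `Eᵒᵖ ⥤ (T ⥤ Set)`
whose values preserve finite products. -/
structure Schema (T : Type u) [SmallCategory T] where
  E : Type u
  [cat : SmallCategory E]
  O : Eᵒᵖ ⥤ (T ⥤ Type u)
  algebraic : ∀ e, PreservesFiniteProducts (O.obj e)

attribute [instance] Schema.cat

variable {T : Type u} [SmallCategory T]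

/-- The objects of the collage of a schema. -/
inductive Collage (S : Schema T) : Type u
  | ent (e : S.E) : Collage S
  | ty (τ : T) : Collage S

namespace Collage

variable {S : Schema T}

/-- The morphisms of the collage. -/
def Hom : Collage S → Collage S → Type u
  | ent e, ent e' => e ⟶ e'
  | ent e, ty τ => (S.O.obj (op e)).obj τ
  | ty _, ent _ => PEmpty
  | ty τ, ty τ' => τ ⟶ τ'

def id : ∀ X : Collage S, Hom X X
  | ent e => 𝟙 e
  | ty τ => 𝟙 τ

def comp : ∀ {X Y Z : Collage S}, Hom X Y → Hom Y Z → Hom X Z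
  | ent _, ent _, ent _, f, g => CategoryStruct.comp (obj := S.E) f g
  | ent _, ent _, ty τ, f, g => (S.O.map (Quiver.Hom.op (V := S.E) f)).app τ g
  | ent e, ty _, ty _, f, g => (S.O.obj (op e)).map g f
  | ty _, ty _, ty _, f, g => CategoryStruct.comp (obj := T) f g
  | ent _, ty _, ent _, _, g => g.elim
  | ty _, ent _, ent _, f, _ => f.elim
  | ty _, ent _, ty _, f, _ => f.elim
  | ty _, ty _, ent _, _, g => g.elim

instance : SmallCategory (Collage S) where
  Hom := Hom
  id := id
  comp := comp
  id_comp {X Y} f := by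
    match X, Y, f with
    | ent _, ent _, f => exact Category.id_comp (obj := S.E) f
    | ent e, ty τ, f =>
      change (S.O.map (𝟙 (op e))).app τ f = f
      simp
      rfl
    | ty _, ent _, f => exact PEmpty.elim f
    | ty _, ty _, f => exact Category.id_comp (obj := T) f
  comp_id {X Y} f := by
    match X, Y, f with
    | ent _, ent _, f => exact Category.comp_id (obj := S.E) f
    | ent e, ty τ, f =>
      change (S.O.obj (op e)).map (𝟙 τ) f = f
      simp
      rfl
    | ty _, ent _, f => exact PEmpty.elim f
    | ty _, ty _, f => exact Category.comp_id (obj := T) f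
  assoc {W X Y Z} f g h := by
    match W, X, Y, Z, f, g, h with
    | ent _, ent _, ent _, ent _, f, g, h => exact Category.assoc (obj := S.E) f g h
    | ent a, ent b, ent c, ty τ, f, g, h =>
      have := ConcreteCategory.congr_hom (NatTrans.congr_app
        (S.O.map_comp (Quiver.Hom.op (V := S.E) g) (Quiver.Hom.op (V := S.E) f)) τ) h
      exact this
    | ent a, ent b, ty τ, ty σ, f, g, h =>
      exact ((S.O.map (Quiver.Hom.op (V := S.E) f)).naturality_apply
        (show (show T from τ) ⟶ σ from h) g).symm
    | ent a, ty τ, ty σ, ty ρ, f, g, h =>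
      exact (ConcreteCategory.congr_hom ((S.O.obj (op a)).map_comp
        (show (show T from τ) ⟶ σ from g) (show (show T from σ) ⟶ ρ from h)) f).symm
    | ty _, ty _, ty _, ty _, f, g, h => exact Category.assoc (obj := T) f g h
    | ty _, ent _, _, _, f, _, _ => exact PEmpty.elim f
    | _, ty _, ent _, _, _, g, _ => exact PEmpty.elim g
    | _, _, ty _, ent _, _, _, h => exact PEmpty.elim h

end Collage

/-- The inclusion of the theory into the collage. -/
def incl (S : Schema T) : T ⥤ Collage S where
  obj := Collage.ty
  map f := f
  map_id _ := rfl
  map_comp _ _ := rfl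

variable (T) in
/-- The property of a functor `T ⥤ Set` of being a `T`-algebra. -/
def isAlg : ObjectProperty (T ⥤ Type u) := fun A => PreservesFiniteProducts A

variable (T) in
/-- The category of `T`-algebras. -/
abbrev Alg := (isAlg T).FullSubcategory

/-- The property of a functor from the collage to sets of being an instance: its restriction to
the theory is an algebra. -/
def isInst (S : Schema T) : ObjectProperty (Collage S ⥤ Type u) :=
  fun I => isAlg T (incl S ⋙ I)

/-- The category of instances on a schema. -/
abbrev Inst (S : Schema T) := (isInst S).FullSubcategory

/-- The restriction of instances to algebras. -/
def restr (S : Schema T) : Inst S ⥤ Alg T :=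
  (isAlg T).lift ((isInst S).ι ⋙ (Functor.whiskeringLeft _ _ _).obj (incl S)) fun I => I.property

lemma isInst_coyoneda (S : Schema T) (r : (Collage S)ᵒᵖ) : isInst S (coyoneda.obj r) := by
  obtain ⟨e | τ⟩ := r
  · exact S.algebraic (op e)
  · change PreservesFiniteProducts (coyoneda.obj (op τ))
    infer_instance

/-- The Yoneda embedding `r ↦ Hom(r, -)` into instances. -/
def yon (S : Schema T) : (Collage S)ᵒᵖ ⥤ Inst S :=
  (isInst S).lift coyoneda (isInst_coyoneda S)

/-- The Yoneda embedding restricted to types. -/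
def typeYon (S : Schema T) : Tᵒᵖ ⥤ Inst S := (incl S).op ⋙ yon S

lemma nonempty_isLimit_fan_iff {J : Type} {X : J → Type u} {P : Type u} (p : ∀ j, P ⟶ X j) :
    Nonempty (IsLimit (Fan.mk P p)) ↔ Function.Bijective (fun (x : P) (j : J) => p j x) := by
  rw [Types.isLimit_iff, Function.bijective_iff_existsUnique]
  constructor
  · intro h b
    obtain ⟨x, hx, hx'⟩ := h (fun j => b j.as) (by
      rintro ⟨i⟩ ⟨j⟩ f
      obtain rfl : i = j := Discrete.eq_of_hom f
      obtain rfl : f = 𝟙 _ := Subsingleton.elim _ _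
      simp)
    exact ⟨x, funext fun j => hx ⟨j⟩, fun y hy => hx' y fun j => congrFun hy j.as⟩
  · intro h s hs
    obtain ⟨x, hx, hx'⟩ := h (fun j => s ⟨j⟩)
    exact ⟨x, fun j => congrFun hx j.as, fun y hy => hx' y (funext fun j => hy ⟨j⟩)⟩

lemma preservesFiniteProducts_iff_bijective [HasFiniteProducts T] (F : T ⥤ Type u) :
    PreservesFiniteProducts F ↔ ∀ (n : ℕ) (τ : Fin n → T),
      Function.Bijective (fun (x : F.obj (∏ᶜ τ)) (i : Fin n) => F.map (Pi.π τ i) x) := by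
  constructor
  · intro h n τ
    rw [← nonempty_isLimit_fan_iff]
    exact ⟨isLimitOfHasProductOfPreservesLimit F τ⟩
  · intro h
    refine ⟨fun n => ?_⟩
    have (τ : Fin n → T) : PreservesLimit (Discrete.functor τ) F := ?_
    · exact preservesLimitsOfShape_of_discrete F
    obtain ⟨hl⟩ := (nonempty_isLimit_fan_iff _).2 (h n τ)
    exact preservesLimit_of_preserves_limit_cone (productIsProduct τ)
      ((isLimitMapConeFanMkEquiv F τ (Pi.π τ)).symm hl)

/-- The morphisms `∐ᵢ Hom(τᵢ, -) ⟶ Hom(∏ᵢ τᵢ, -)`. -/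
noncomputable def prodMap [HasFiniteProducts T] (S : Schema T) (p : Σ n : ℕ, Fin n → T) :
    (∐ fun i => coyoneda.obj (op ((incl S).obj (p.2 i)))) ⟶
      coyoneda.obj (op ((incl S).obj (∏ᶜ p.2))) :=
  Sigma.desc fun i => coyoneda.map ((incl S).map (Pi.π p.2 i)).op

lemma isInst_eq [HasFiniteProducts T] (S : Schema T) :
    isInst S = (MorphismProperty.ofHoms (prodMap S)).isLocal := by
  ext I
  refine (preservesFiniteProducts_iff_bijective (incl S ⋙ I)).trans ?_
  have key : ∀ (n : ℕ) (τ : Fin n → T),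
      Function.Bijective (fun (x : (incl S ⋙ I).obj (∏ᶜ τ)) (i : Fin n) =>
        (incl S ⋙ I).map (Pi.π τ i) x) ↔
      Function.Bijective (fun g : coyoneda.obj (op ((incl S).obj (∏ᶜ τ))) ⟶ I =>
        prodMap S ⟨n, τ⟩ ≫ g) := by
    intro n τ
    let e : ((∐ fun i => coyoneda.obj (op ((incl S).obj (τ i)))) ⟶ I) ≃
        ∀ i : Fin n, (incl S ⋙ I).obj (τ i) :=
      { toFun g i := coyonedaEquiv (F := I) (X := (incl S).obj (τ i)) (Sigma.ι (fun i => coyoneda.obj (op ((incl S).obj (τ i)))) i ≫ g)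
        invFun x := Sigma.desc fun i =>
          (coyonedaEquiv (F := I) (X := (incl S).obj (τ i))).symm (x i)
        left_inv g := by
          apply Sigma.hom_ext
          intro i
          simp
        right_inv x := by
          ext i
          simp }
    have : (fun (x : (incl S ⋙ I).obj (∏ᶜ τ)) (i : Fin n) =>
        (incl S ⋙ I).map (Pi.π τ i) x) ∘ (coyonedaEquiv (F := I) (X := (incl S).obj (∏ᶜ τ))) =
        e ∘ (fun g : coyoneda.obj (op ((incl S).obj (∏ᶜ τ))) ⟶ I => prodMap S ⟨n, τ⟩ ≫ g) := by
      ext g i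
      simp only [Function.comp, e, Equiv.coe_fn_mk, prodMap]
      rw [← Category.assoc, Sigma.ι_desc]
      exact (coyonedaEquiv_naturality g _)
    rw [← Function.Bijective.of_comp_iff _
      (coyonedaEquiv (F := I) (X := (incl S).obj (∏ᶜ τ))).bijective, this,
      Function.Bijective.of_comp_iff' e.bijective]
  constructor
  · rintro h _ _ _ ⟨n, τ⟩
    exact (key n τ).1 (h n τ)
  · intro h n τ
    exact (key n τ).2 (h (prodMap S ⟨n, τ⟩) (MorphismProperty.ofHoms.mk _))

instance fact_aleph0 : Fact (Cardinal.aleph0.{u}).IsRegular := ⟨Cardinal.isRegular_aleph0⟩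

instance {C : Type u} [SmallCategory C] (κ : Cardinal.{u}) [Fact κ.IsRegular] (X : Cᵒᵖ) :
    IsCardinalPresentable (coyoneda.obj X) κ where
  preservesColimitOfShape J _ _ := by
    let e : coyoneda.obj (op (coyoneda.obj X)) ≅ (evaluation C (Type u)).obj X.unop :=
      NatIso.ofComponents (fun P ↦ Equiv.toIso coyonedaEquiv)
    exact preservesColimitsOfShape_of_natIso e.symm

instance inst_isRightAdjoint [HasFiniteProducts T] (S : Schema T) :
    (isInst S).ι.IsRightAdjoint := by
  rw [isInst_eq]
  refine MorphismProperty.isRightAdjoint_ι_isLocal _ Cardinal.aleph0.{u} ?_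
  rintro _ _ _ ⟨n, τ⟩
  refine ⟨?_, inferInstance⟩
  have (j : Discrete (Fin n)) : IsCardinalPresentable ((Discrete.functor
    fun i => coyoneda.obj (op ((incl S).obj (τ i)))).obj j) Cardinal.aleph0.{u} := by
    dsimp; infer_instance
  exact isCardinalPresentable_of_isColimit _ (coproductIsCoproduct
    fun i => coyoneda.obj (op ((incl S).obj (τ i)))) Cardinal.aleph0.{u}
    (hasCardinalLT_of_finite _ _ le_rfl)

instance inst_hasColimits [HasFiniteProducts T] (S : Schema T) :
    HasColimitsOfSize.{u, u} (Inst S) := by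
  let : Reflective (isInst S).ι := ⟨_, Adjunction.ofIsRightAdjoint _⟩
  exact hasColimits_of_reflective (isInst S).ι

section slices

universe v₁ v₂ v₃ v₄ u₁ u₂ u₃ u₄

variable {A : Type u₁} [Category.{v₁} A] {C : Type u₂} [Category.{v₂} C]
  {D : Type u₃} [Category.{v₃} D] {D' : Type u₄} [Category.{v₄} D']

/-- The 1-cells `(C, F) ⟶ (D, G)` of the coslice 2-category `A / CAT`: functors `H : C ⥤ D`
with `F ⋙ H = G`. -/
structure CosliceHom (F : A ⥤ C) (G : A ⥤ D) where
  functor : C ⥤ D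
  w : F ⋙ functor = G

namespace CosliceHom

variable {F : A ⥤ C} {G : A ⥤ D} {G' : A ⥤ D'}

lemma obj_eq (H : CosliceHom F G) (a : A) : H.functor.obj (F.obj a) = G.obj a :=
  Functor.congr_obj H.w a

/-- The 2-cells `H ⟶ H'` of the coslice 2-category: natural transformations whose restriction
along `F` is the identity of `G`. -/
@[ext]
structure Hom (H H' : CosliceHom F G) where
  nat : H.functor ⟶ H'.functor
  restrict : ∀ a, nat.app (F.obj a) = eqToHom ((H.obj_eq a).trans (H'.obj_eq a).symm)

instance : Category (CosliceHom F G) where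
  Hom := Hom
  id H := { nat := 𝟙 _, restrict := fun a => by simp }
  comp f g := { nat := f.nat ≫ g.nat, restrict := fun a => by simp [f.restrict, g.restrict] }

@[simp]
lemma id_nat (H : CosliceHom F G) : Hom.nat (𝟙 H) = 𝟙 H.functor := rfl

lemma comp_nat {H H' H'' : CosliceHom F G} (f : H ⟶ H') (g : H' ⟶ H'') :
    Hom.nat (f ≫ g) = Hom.nat f ≫ Hom.nat g := rfl

@[simp]
lemma comp_nat_app {H H' H'' : CosliceHom F G} (f : H ⟶ H') (g : H' ⟶ H'') (c : C) :
    (Hom.nat (f ≫ g)).app c = (Hom.nat f).app c ≫ (Hom.nat g).app c := rfl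

@[ext]
lemma hom_ext {H H' : CosliceHom F G} {f g : H ⟶ H'} (h : Hom.nat f = Hom.nat g) : f = g := Hom.ext h

@[simp]
lemma hom_inv_app {H H' : CosliceHom F G} (e : H ≅ H') (c : C) :
    (Hom.nat e.hom).app c ≫ (Hom.nat e.inv).app c = 𝟙 _ :=
  NatTrans.congr_app (congrArg Hom.nat e.hom_inv_id) c

@[simp]
lemma hom_inv_app_assoc {H H' : CosliceHom F G} (e : H ≅ H') (c : C) {X : D} (f : H.functor.obj c ⟶ X) :
    (Hom.nat e.hom).app c ≫ (Hom.nat e.inv).app c ≫ f = f := by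
  rw [← Category.assoc, hom_inv_app, Category.id_comp]

@[simp]
lemma inv_hom_app {H H' : CosliceHom F G} (e : H ≅ H') (c : C) :
    (Hom.nat e.inv).app c ≫ (Hom.nat e.hom).app c = 𝟙 _ :=
  NatTrans.congr_app (congrArg Hom.nat e.inv_hom_id) c

@[simp]
lemma inv_hom_app_assoc {H H' : CosliceHom F G} (e : H ≅ H') (c : C) {X : D} (f : H'.functor.obj c ⟶ X) :
    (Hom.nat e.inv).app c ≫ (Hom.nat e.hom).app c ≫ f = f := by
  rw [← Category.assoc, inv_hom_app, Category.id_comp]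

@[simps]
def appIso {H H' : CosliceHom F G} (e : H ≅ H') (c : C) : H.functor.obj c ≅ H'.functor.obj c where
  hom := (Hom.nat e.hom).app c
  inv := (Hom.nat e.inv).app c

@[simps]
def isoMk {H H' : CosliceHom F G} (e : H.functor ≅ H'.functor)
    (h : ∀ a, e.hom.app (F.obj a) = eqToHom ((H.obj_eq a).trans (H'.obj_eq a).symm)) :
    H ≅ H' where
  hom := ⟨e.hom, h⟩
  inv := ⟨e.inv, fun a => by
    have : e.inv.app (F.obj a) = inv (e.hom.app (F.obj a)) := by simp
    rw [this]
    simp only [h, inv_eqToHom]⟩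

end CosliceHom

/-- The 1-cells `(C, U) ⟶ (D, V)` of the slice 2-category `CAT / A`: functors `H : C ⥤ D` with
`H ⋙ V = U`. -/
structure SliceHom (U : C ⥤ A) (V : D ⥤ A) where
  functor : C ⥤ D
  w : functor ⋙ V = U

namespace SliceHom

variable {U : C ⥤ A} {V : D ⥤ A}

lemma obj_eq (H : SliceHom U V) (c : C) : V.obj (H.functor.obj c) = U.obj c :=
  Functor.congr_obj H.w c

/-- The 2-cells `H ⟶ H'` of the slice 2-category: natural transformations whose image under `V`
is the identity of `U`. -/
@[ext]
structure Hom (H H' : SliceHom U V) where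
  nat : H.functor ⟶ H'.functor
  proj : ∀ c, V.map (nat.app c) = eqToHom ((H.obj_eq c).trans (H'.obj_eq c).symm)

instance : Category (SliceHom U V) where
  Hom := Hom
  id H := { nat := 𝟙 _, proj := fun c => by simp }
  comp f g := { nat := f.nat ≫ g.nat, proj := fun c => by simp [f.proj, g.proj] }

@[simp]
lemma id_nat (H : SliceHom U V) : Hom.nat (𝟙 H) = 𝟙 H.functor := rfl

lemma comp_nat {H H' H'' : SliceHom U V} (f : H ⟶ H') (g : H' ⟶ H'') :
    Hom.nat (f ≫ g) = Hom.nat f ≫ Hom.nat g := rfl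

@[simp]
lemma comp_nat_app {H H' H'' : SliceHom U V} (f : H ⟶ H') (g : H' ⟶ H'') (c : C) :
    (Hom.nat (f ≫ g)).app c = (Hom.nat f).app c ≫ (Hom.nat g).app c := rfl

@[ext]
lemma hom_ext {H H' : SliceHom U V} {f g : H ⟶ H'} (h : Hom.nat f = Hom.nat g) : f = g := Hom.ext h

@[simp]
lemma hom_inv_app {H H' : SliceHom U V} (e : H ≅ H') (c : C) :
    (Hom.nat e.hom).app c ≫ (Hom.nat e.inv).app c = 𝟙 _ :=
  NatTrans.congr_app (congrArg Hom.nat e.hom_inv_id) c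

@[simp]
lemma hom_inv_app_assoc {H H' : SliceHom U V} (e : H ≅ H') (c : C) {X : D} (f : H.functor.obj c ⟶ X) :
    (Hom.nat e.hom).app c ≫ (Hom.nat e.inv).app c ≫ f = f := by
  rw [← Category.assoc, hom_inv_app, Category.id_comp]

@[simp]
lemma inv_hom_app {H H' : SliceHom U V} (e : H ≅ H') (c : C) :
    (Hom.nat e.inv).app c ≫ (Hom.nat e.hom).app c = 𝟙 _ :=
  NatTrans.congr_app (congrArg Hom.nat e.inv_hom_id) c

@[simp]
lemma inv_hom_app_assoc {H H' : SliceHom U V} (e : H ≅ H') (c : C) {X : D} (f : H'.functor.obj c ⟶ X) :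
    (Hom.nat e.inv).app c ≫ (Hom.nat e.hom).app c ≫ f = f := by
  rw [← Category.assoc, inv_hom_app, Category.id_comp]

@[simps]
def isoMk {H H' : SliceHom U V} (e : H.functor ≅ H'.functor)
    (h : ∀ c, V.map (e.hom.app c) = eqToHom ((H.obj_eq c).trans (H'.obj_eq c).symm)) :
    H ≅ H' where
  hom := ⟨e.hom, h⟩
  inv := ⟨e.inv, fun c => by
    have : V.map (e.inv.app c) = inv (V.map (e.hom.app c)) := by
      rw [← Functor.map_inv]; simp
    rw [this]
    simp only [h, inv_eqToHom]⟩

end SliceHom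

section strictify

variable {F : A ⥤ C} {L K : C ⥤ D} (γ : F ⋙ L ≅ F ⋙ K)

open Classical in
noncomputable def strictObj (F : A ⥤ C) (L K : C ⥤ D) (c : C) : D :=
  if ∃ a, F.obj a = c then K.obj c else L.obj c

noncomputable def strictIsoOfExists (c : C) (h : ∃ a, F.obj a = c) : L.obj c ≅ K.obj c :=
  L.mapIso (eqToIso h.choose_spec.symm) ≪≫ γ.app h.choose ≪≫ K.mapIso (eqToIso h.choose_spec)

open Classical in
noncomputable def strictIso (c : C) : L.obj c ≅ strictObj F L K c :=
  if h : ∃ a, F.obj a = c then strictIsoOfExists γ c h ≪≫ eqToIso (if_pos h).symm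
  else eqToIso (if_neg h).symm

/-- Replacement of a functor `L` with an isomorphism `F ⋙ L ≅ F ⋙ K` by an isomorphic functor
whose composite with `F` is equal to `F ⋙ K`. -/
noncomputable def strictify : C ⥤ D := L.copyObj (strictObj F L K) (strictIso γ)

noncomputable def isoStrictify : L ≅ strictify γ := L.isoCopyObj _ _

lemma strictify_obj (a : A) : (strictify γ).obj (F.obj a) = K.obj (F.obj a) :=
  if_pos ⟨a, rfl⟩

lemma isoStrictify_hom_app [F.Full] (a : A) :
    (isoStrictify γ).hom.app (F.obj a) = γ.hom.app a ≫ eqToHom (strictify_obj γ a).symm := by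
  have h : ∃ b, F.obj b = F.obj a := ⟨a, rfl⟩
  have h1 : (isoStrictify γ).hom.app (F.obj a) = (strictIso γ (F.obj a)).hom := rfl
  have h2 : (strictIsoOfExists γ (F.obj a) h).hom = γ.hom.app a := by
    obtain ⟨f, hf⟩ := F.map_surjective (eqToHom h.choose_spec)
    have := γ.hom.naturality f
    simp only [Functor.comp_map, hf] at this
    simp only [strictIsoOfExists, Iso.trans_hom, Functor.mapIso_hom, eqToIso.hom, Iso.app_hom]
    rw [← this, ← Functor.map_comp_assoc]
    simp
  rw [h1, strictIso, dif_pos h, Iso.trans_hom, h2]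
  rfl

lemma comp_strictify [F.Full] : F ⋙ strictify γ = F ⋙ K := by
  refine CategoryTheory.Functor.ext (fun a => strictify_obj γ a) (fun a b f => ?_)
  have h := (isoStrictify γ).hom.naturality (F.map f)
  rw [isoStrictify_hom_app, isoStrictify_hom_app] at h
  have h' := γ.hom.naturality f
  simp only [Functor.comp_map] at h'
  rw [reassoc_of% h', Category.assoc, cancel_epi] at h
  simp only [Functor.comp_map]
  rw [← cancel_epi (eqToHom (strictify_obj γ a).symm), ← h]
  simp

end strictify

end slices

variable {T : Type u} [SmallCategory T]

instance (S : Schema T) : (incl S).Full := ⟨fun f => ⟨f, rfl⟩⟩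

instance (S : Schema T) : (yon S).Full := inferInstanceAs ((isInst S).lift _ _).Full
instance (S : Schema T) : (yon S).Faithful := inferInstanceAs ((isInst S).lift _ _).Faithful
instance (S : Schema T) : (typeYon S).Full := inferInstanceAs ((incl S).op ⋙ yon S).Full

/-- The extension of a `T`-algebra to the collage by the empty set on entities. -/
def extObj (S : Schema T) (A : T ⥤ Type u) : Collage S → Type u
  | .ent _ => PEmpty
  | .ty τ => A.obj τ

def extMap (S : Schema T) (A : T ⥤ Type u) :
    ∀ {X Y : Collage S}, (X ⟶ Y) → (extObj S A X → extObj S A Y)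
  | .ent _, _, _ => fun x => x.elim
  | .ty _, .ent _, f => PEmpty.elim f
  | .ty τ, .ty σ, f => A.map (X := τ) (Y := σ) f

def extFunctorObj (S : Schema T) (A : T ⥤ Type u) : Collage S ⥤ Type u where
  obj := extObj S A
  map f := ↾(extMap S A f)
  map_id X := by
    ext x
    match X, x with
    | .ty τ, x => exact ConcreteCategory.congr_hom (A.map_id τ) x
  map_comp {X Y Z} f g := by
    ext x
    match X, Y, Z, f, g, x with
    | .ty τ, .ty σ, .ty ρ, f, g, x =>
      exact ConcreteCategory.congr_hom (A.map_comp (X := τ) (Y := σ) (Z := ρ) f g) x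
    | .ty τ, .ent _, _, f, g, x => exact PEmpty.elim f
    | .ty _, .ty _, .ent _, f, g, x => exact PEmpty.elim g

def ext (S : Schema T) : Alg T ⥤ Inst S where
  obj A := ⟨extFunctorObj S A.obj, A.property⟩
  map {A B} f := ObjectProperty.homMk
    { app := fun X => ↾(match X with
        | .ent _ => fun x => x
        | .ty τ => f.hom.app τ : extObj S A.obj X → extObj S B.obj X)
      naturality := by
        intro X Y g
        ext x
        match X, Y, g, x with
        | .ty τ, .ty σ, g, x => exact f.hom.naturality_apply (X := τ) (Y := σ) g x
        | .ty _, .ent _, g, x => exact PEmpty.elim g }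
  map_id A := by
    apply ObjectProperty.hom_ext
    ext X x
    match X, x with
    | .ty τ, x => rfl
  map_comp f g := by
    apply ObjectProperty.hom_ext
    ext X x
    match X, x with
    | .ty τ, x => rfl

lemma inst_eqToHom_app {S : Schema T} {I J : Inst S} (h : I = J) (X : Collage S) :
    (eqToHom h).hom.app X = eqToHom (by rw [h]) := by
  subst h
  rfl

lemma alg_eqToHom_app {I J : Alg T} (h : I = J) (τ : T) :
    (eqToHom h).hom.app τ = eqToHom (by rw [h]) := by
  subst h
  rfl

lemma typeYon_obj_eq (R S : Schema T) (τ : Tᵒᵖ) :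
    (typeYon R ⋙ restr R ⋙ ext S).obj τ = (typeYon S).obj τ := by
  apply ObjectProperty.FullSubcategory.ext
  refine CategoryTheory.Functor.ext (fun X => by cases X <;> rfl) (fun X Y f => ?_)
  match X, Y, f with
  | .ty _, .ty _, f => rfl
  | .ty _, .ent _, f => exact PEmpty.elim f
  | .ent _, _, f =>
    ext x
    exact PEmpty.elim x

lemma typeYon_eq (R S : Schema T) : typeYon R ⋙ restr R ⋙ ext S = typeYon S := by
  refine CategoryTheory.Functor.ext (typeYon_obj_eq R S) (fun τ σ f => ?_)
  apply ObjectProperty.hom_ext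
  ext X x
  match X, x with
  | .ty ρ, x =>
    simp only [ObjectProperty.FullSubcategory.comp_hom, NatTrans.comp_app, inst_eqToHom_app]
    rfl
  | .ent _, x => exact PEmpty.elim x

/-- A bimodule `R ⇸ S`: a functor `Rᵒᵖ ⥤ Inst S` on the opposite of the collage of `R` which
agrees with the Yoneda embedding on types. The morphisms of bimodules are the natural
transformations which restrict to the identity on types. -/
abbrev Bimodule (R S : Schema T) := CosliceHom (incl R).op (typeYon S)

/-- The Yoneda lemma for instances. -/
def yonEquiv {S : Schema T} {r : Collage S} {I : Inst S} :
    ((yon S).obj (op r) ⟶ I) ≃ I.obj.obj r :=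
  ((isInst S).fullyFaithfulι.homEquiv).trans coyonedaEquiv

lemma yonEquiv_comp {S : Schema T} {r : Collage S} {I J : Inst S}
    (f : (yon S).obj (op r) ⟶ I) (g : I ⟶ J) :
    yonEquiv (f ≫ g) = g.hom.app r (yonEquiv f) := rfl

lemma yonEquiv_map {S : Schema T} {r s : Collage S} {I : Inst S}
    (f : (yon S).obj (op r) ⟶ I) (g : r ⟶ s) :
    yonEquiv ((yon S).map g.op ≫ f) = I.obj.map g (yonEquiv f) :=
  (coyonedaEquiv_naturality f.hom g).symm

lemma yonEquiv_symm_map {S : Schema T} {r s : Collage S} {I : Inst S}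
    (x : I.obj.obj r) (g : r ⟶ s) :
    yonEquiv.symm (I.obj.map g x) = (yon S).map g.op ≫ yonEquiv.symm x := by
  apply yonEquiv.injective
  rw [yonEquiv_map]; simp

lemma yonEquiv_symm_comp {S : Schema T} {r : Collage S} {I J : Inst S}
    (x : I.obj.obj r) (g : I ⟶ J) :
    yonEquiv.symm x ≫ g = yonEquiv.symm (g.hom.app r x) := by
  apply yonEquiv.injective
  rw [yonEquiv_comp]; simp

section eqToHom

variable {C : Type*} [Category* C]

lemma eqToHom_aux₁ {X Y Z W : C} (a : X = Y) (b : Y = X) (f : X ⟶ Z) (g : Z ⟶ W) :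
    eqToHom a ≫ (eqToHom b ≫ f) ≫ g = f ≫ g := by
  subst a; simp

lemma eqToHom_aux₂ {X Y Z W V : C} (a : X = Y) (b : Y = X) (c : Z = W) (d : W = Z)
    (f : X ⟶ Z) (g : Z ⟶ V) :
    eqToHom a ≫ (eqToHom b ≫ f ≫ eqToHom c) ≫ eqToHom d ≫ g = f ≫ g := by
  subst a c; simp

lemma eqToHom_aux₃ {X Y Z W : C} (f : X ⟶ Y) [IsIso f] (a : X = Z) (b : Z = W) :
    f ≫ (inv f ≫ eqToHom a) ≫ eqToHom b = eqToHom (a.trans b) := by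
  subst a b; simp

end eqToHom

section kan

variable {R S : Schema T} (M : (Collage R)ᵒᵖ ⥤ Inst S)

instance [HasFiniteProducts T] : (yon R).HasPointwiseLeftKanExtension M := fun _ => inferInstance

/-- The functor `J ↦ Hom(M(-), J)`. -/
def nerve : Inst S ⥤ (Collage R ⥤ Type u) where
  obj J :=
    { obj r := M.obj (op r) ⟶ J
      map g := ↾fun f => M.map g.op ≫ f
      map_id r := by ext f; simp
      map_comp g h := by ext f; simp }
  map φ := { app r := ↾fun f => f ≫ φ }

variable {M} (L : Inst R ⥤ Inst S) (η : M ⟶ yon R ⋙ L)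

def nerveMap (I : Inst R) (J : Inst S) (f : L.obj I ⟶ J) : I.obj ⟶ (nerve M).obj J where
  app r := ↾fun x => η.app (op r) ≫ L.map (yonEquiv.symm x) ≫ f
  naturality r s g := by
    ext x
    have := η.naturality g.op
    simp only [Functor.comp_map] at this
    simp [nerve, yonEquiv_symm_map, reassoc_of% this]

lemma nerveMap_bijective [HasFiniteProducts T] [L.IsLeftKanExtension η] (I : Inst R) (J : Inst S) :
    Function.Bijective (nerveMap L η I J) := by
  have hp : IsColimit ((Functor.LeftExtension.mk L η).coconeAt I) :=
    (Functor.isPointwiseLeftKanExtensionOfIsLeftKanExtension L η) I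
  constructor
  · intro f g h
    refine Functor.LeftExtension.IsPointwiseLeftKanExtensionAt.hom_ext' hp fun r p => ?_
    have := ConcreteCategory.congr_hom (NatTrans.congr_app h r.unop) (yonEquiv p)
    change η.app r ≫ L.map (yonEquiv.symm (yonEquiv p)) ≫ f =
      η.app r ≫ L.map (yonEquiv.symm (yonEquiv p)) ≫ g at this
    rw [Equiv.symm_apply_apply] at this
    exact this
  · intro g
    let c : Cocone (CostructuredArrow.proj (yon R) I ⋙ M) :=
      { pt := J
        ι :=
          { app p := g.app p.left.unop (yonEquiv p.hom)
            naturality := by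
              intro p q f
              have h1 := g.naturality_apply f.left.unop (yonEquiv q.hom)
              have h2 := yonEquiv_map q.hom f.left.unop
              have h3 : yonEquiv p.hom = I.obj.map f.left.unop (yonEquiv q.hom) := by
                rw [← h2, ← CostructuredArrow.w f]
                rfl
              simp only [Functor.comp_map, CostructuredArrow.proj_map, Functor.const_obj_map,
                Functor.const_obj_obj]
              rw [h3, h1]
              rfl } }
    refine ⟨hp.desc c, ?_⟩
    ext r x
    have := hp.fac c (CostructuredArrow.mk (Y := op r) (yonEquiv.symm x))
    simp only [Functor.LeftExtension.coconeAt_ι_app] at this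
    have h4 : c.ι.app (CostructuredArrow.mk (Y := op r) (yonEquiv.symm x)) = g.app r x :=
      congrArg (g.app r) (yonEquiv.apply_symm_apply x)
    exact (Category.assoc _ _ _).symm.trans (this.trans h4)

lemma nerveMap_naturality_left {I I' : Inst R} (J : Inst S) (f : L.obj I ⟶ J) (h : I' ⟶ I) :
    nerveMap L η I' J (L.map h ≫ f) = h.hom ≫ nerveMap L η I J f := by
  ext r x
  simp only [nerveMap, NatTrans.comp_app]
  change _ ≫ _ ≫ _ ≫ _ = _ ≫ L.map (yonEquiv.symm (h.hom.app r x)) ≫ f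
  rw [← yonEquiv_symm_comp]
  simp

lemma nerveMap_naturality_right (I : Inst R) {J J' : Inst S} (f : L.obj I ⟶ J) (h : J ⟶ J') :
    nerveMap L η I J' (f ≫ h) = nerveMap L η I J f ≫ (nerve M).map h := by
  ext r x
  simp [nerveMap, nerve]

noncomputable def nerveEquiv [HasFiniteProducts T] [L.IsLeftKanExtension η] (I : Inst R) (J : Inst S) :
    (L.obj I ⟶ J) ≃ (I.obj ⟶ (nerve M).obj J) :=
  Equiv.ofBijective _ (nerveMap_bijective L η I J)

end kan

/-- `Γ_M J` on objects: `Hom(M e, J)` at an entity `e`, and `J τ = Hom(y τ, J)` at a type `τ`. -/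
def gammaCar {R S : Schema T} (M : Bimodule R S) (J : Inst S) : Collage R → Type u
  | .ent e => M.functor.obj (op (.ent e)) ⟶ J
  | .ty τ => J.obj.obj (.ty τ)

def gammaTyIso {R S : Schema T} (M : Bimodule R S) (J : Inst S) (τ : T) :
    (M.functor.obj (op (.ty τ)) ⟶ J) ≅ J.obj.obj (.ty τ) :=
  ((eqToIso (M.obj_eq (op τ))).homFromEquiv.trans yonEquiv).toIso

def gammaIso {R S : Schema T} (M : Bimodule R S) (J : Inst S) :
    ∀ r : Collage R, ((nerve M.functor).obj J).obj r ≅ gammaCar M J r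
  | .ent _ => Iso.refl _
  | .ty τ => gammaTyIso M J τ

def gammaObj {R S : Schema T} (M : Bimodule R S) (J : Inst S) : Collage R ⥤ Type u :=
  ((nerve M.functor).obj J).copyObj (gammaCar M J) (gammaIso M J)

lemma incl_gammaObj  {R S : Schema T} (M : Bimodule R S) (J : Inst S) :
    incl R ⋙ gammaObj M J = incl S ⋙ J.obj := by
  refine CategoryTheory.Functor.ext (fun τ => rfl) fun τ σ f => ?_
  ext x
  have h1 := Functor.congr_hom M.w f.op
  change yonEquiv (eqToHom (M.obj_eq (op σ)).symm ≫ M.functor.map ((incl R).map f).op ≫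
    eqToHom (M.obj_eq (op τ)) ≫ yonEquiv.symm x) = J.obj.map ((incl S).map f) x
  simp only [Functor.comp_map, Functor.op_map, Quiver.Hom.unop_op] at h1
  rw [h1]
  refine (congrArg yonEquiv (eqToHom_aux₂ _ _ _ _ _ _)).trans ?_
  change yonEquiv ((yon S).map ((incl S).map f).op ≫ yonEquiv.symm x) = _
  rw [yonEquiv_map]
  exact congrArg _ (yonEquiv.apply_symm_apply x)

lemma isInst_gammaObj {R S : Schema T} (M : Bimodule R S) (J : Inst S) :
    isInst R (gammaObj M J) := by
  unfold isInst
  rw [incl_gammaObj]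
  exact J.property

/-- The underlying functor of `Γ_M`. -/
def gammaFunctor {R S : Schema T} (M : Bimodule R S) : Inst S ⥤ Inst R :=
  (isInst R).lift
    ((nerve M.functor).copyObj (gammaObj M) fun J =>
      ((nerve M.functor).obj J).isoCopyObj (gammaCar M J) (gammaIso M J))
    (isInst_gammaObj M)

def gammaFunctorIso {R S : Schema T} (M : Bimodule R S) :
    gammaFunctor M ⋙ (isInst R).ι ≅ nerve M.functor :=
  ((nerve M.functor).isoCopyObj (gammaObj M) fun J =>
      ((nerve M.functor).obj J).isoCopyObj (gammaCar M J) (gammaIso M J)).symm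

lemma gammaFunctor_w_obj {R S : Schema T} (M : Bimodule R S) (J : Inst S) :
    (restr R).obj ((gammaFunctor M).obj J) = (restr S).obj J :=
  ObjectProperty.FullSubcategory.ext (incl_gammaObj M J)

lemma gammaFunctor_w {R S : Schema T} (M : Bimodule R S) :
    gammaFunctor M ⋙ restr R = restr S := by
  refine CategoryTheory.Functor.ext (fun J => gammaFunctor_w_obj M J) fun J J' f => ?_
  apply ObjectProperty.hom_ext
  ext τ x
  simp only [ObjectProperty.FullSubcategory.comp_hom, NatTrans.comp_app, alg_eqToHom_app]
  change yonEquiv (eqToHom (M.obj_eq (op τ)).symm ≫ (eqToHom (M.obj_eq (op τ)) ≫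
    yonEquiv.symm x) ≫ f) = f.hom.app _ x
  refine (congrArg yonEquiv (eqToHom_aux₁ _ _ _ _)).trans ?_
  rw [yonEquiv_comp]
  exact congrArg _ (yonEquiv.apply_symm_apply x)

/-- `Γ_M` as a 1-cell over `T`-algebras. -/
def gamma {R S : Schema T} (M : Bimodule R S) : SliceHom (restr S) (restr R) where
  functor := gammaFunctor M
  w := gammaFunctor_w M

section lambda

variable [HasFiniteProducts T] {R S : Schema T} (M : Bimodule R S)

/-- The left Kan extension of a bimodule along the Yoneda embedding. -/
noncomputable def lan : Inst R ⥤ Inst S := (yon R).leftKanExtension M.functor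

noncomputable def lanUnit : M.functor ⟶ yon R ⋙ lan M := (yon R).leftKanExtensionUnit M.functor

instance : (lan M).IsLeftKanExtension (lanUnit M) :=
  by unfold lan lanUnit; infer_instance

instance : IsIso (lanUnit M) :=
  (Functor.isPointwiseLeftKanExtensionOfIsLeftKanExtension (lan M) (lanUnit M)).isIso_hom

noncomputable def lanTypeIso : typeYon R ⋙ lan M ≅ typeYon R ⋙ (restr R ⋙ ext S) :=
  Functor.isoWhiskerLeft (incl R).op (asIso (lanUnit M)).symm ≪≫
    eqToIso (M.w.trans (typeYon_eq R S).symm)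

/-- The underlying functor of `Λ_M`: the left Kan extension of `M` along the Yoneda embedding,
chosen among the isomorphic ones so that it strictly preserves types. -/
noncomputable def lambdaFunctor : Inst R ⥤ Inst S := strictify (lanTypeIso M)

/-- `Λ_M` as a 1-cell under `Tᵒᵖ`. -/
noncomputable def lambda : CosliceHom (typeYon R) (typeYon S) where
  functor := lambdaFunctor M
  w := (comp_strictify _).trans (typeYon_eq R S)

/-- The isomorphism exhibiting `Λ_M` as an extension of `M`. -/
noncomputable def lambdaUnit : M.functor ≅ yon R ⋙ (lambda M).functor :=
  asIso (lanUnit M) ≪≫ Functor.isoWhiskerLeft (yon R) (isoStrictify (lanTypeIso M))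

instance : (lambda M).functor.IsLeftKanExtension (lambdaUnit M).hom :=
  Functor.isLeftKanExtension_of_iso (isoStrictify (lanTypeIso M)) (lanUnit M) _ rfl

lemma lambdaUnit_type (τ : Tᵒᵖ) :
    (lambdaUnit M).hom.app ((incl R).op.obj τ) =
      eqToHom ((M.obj_eq τ).trans ((lambda M).obj_eq τ).symm) := by
  have h := isoStrictify_hom_app (lanTypeIso M) τ
  change (lanUnit M).app _ ≫ (isoStrictify (lanTypeIso M)).hom.app ((typeYon R).obj τ) = _
  rw [h]
  have h2 : (lanTypeIso M).hom.app τ = inv ((lanUnit M).app ((incl R).op.obj τ)) ≫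
      eqToHom (Functor.congr_obj (M.w.trans (typeYon_eq R S).symm) τ) := by
    change (inv (lanUnit M)).app _ ≫
      NatTrans.app (eqToHom (M.w.trans (typeYon_eq R S).symm)) τ = _
    rw [eqToHom_app, NatIso.isIso_inv_app]
  rw [h2]
  exact eqToHom_aux₃ _ _ _

noncomputable def lambdaHomEquiv (I : Inst R) (J : Inst S) :
    ((lambda M).functor.obj I ⟶ J) ≃ (I ⟶ (gamma M).functor.obj J) :=
  (nerveEquiv (lambda M).functor (lambdaUnit M).hom I J).trans
    (((gammaFunctorIso M).symm.app J).homToEquiv.trans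
      ((isInst R).fullyFaithfulι.homEquiv (X := I) (Y := (gammaFunctor M).obj J)).symm)

lemma lambdaHomEquiv_hom (I : Inst R) (J : Inst S) (f : (lambda M).functor.obj I ⟶ J) :
    (lambdaHomEquiv M I J f).hom =
      nerveMap (lambda M).functor (lambdaUnit M).hom I J f ≫ (gammaFunctorIso M).inv.app J :=
  rfl

lemma lambdaHomEquiv_left {I I' : Inst R} {J : Inst S} (f : (lambda M).functor.obj I ⟶ J)
    (h : I' ⟶ I) : lambdaHomEquiv M I' J ((lambda M).functor.map h ≫ f) =
      h ≫ lambdaHomEquiv M I J f := by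
  apply ObjectProperty.hom_ext
  rw [lambdaHomEquiv_hom, ObjectProperty.FullSubcategory.comp_hom, lambdaHomEquiv_hom,
    nerveMap_naturality_left, Category.assoc]
  rfl

lemma lambdaHomEquiv_right {I : Inst R} {J J' : Inst S} (f : (lambda M).functor.obj I ⟶ J)
    (g : J ⟶ J') : lambdaHomEquiv M I J' (f ≫ g) =
      lambdaHomEquiv M I J f ≫ (gamma M).functor.map g := by
  apply ObjectProperty.hom_ext
  rw [lambdaHomEquiv_hom, ObjectProperty.FullSubcategory.comp_hom, lambdaHomEquiv_hom,
    nerveMap_naturality_right, Category.assoc]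
  refine (congrArg (fun x => _ ≫ x) ((gammaFunctorIso M).inv.naturality g)).trans ?_
  exact (Category.assoc _ _ _).symm

/-- The adjunction `Λ_M ⊣ Γ_M`. -/
noncomputable def lambdaAdj : (lambda M).functor ⊣ (gamma M).functor :=
  Adjunction.mkOfHomEquiv
    { homEquiv := lambdaHomEquiv M
      homEquiv_naturality_left_symm := fun f g => by
        rw [Equiv.symm_apply_eq, lambdaHomEquiv_left, Equiv.apply_symm_apply]
      homEquiv_naturality_right := fun f g => lambdaHomEquiv_right M f g }

instance : (lambda M).functor.IsLeftAdjoint := (lambdaAdj M).isLeftAdjoint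
instance : (gamma M).functor.IsRightAdjoint := (lambdaAdj M).isRightAdjoint

end lambda

section slices

universe v₁ v₂ v₃ v₄ v₅ u₁ u₂ u₃ u₄ u₅

variable {A : Type u₁} [Category.{v₁} A] {C : Type u₂} [Category.{v₂} C]
  {D : Type u₃} [Category.{v₃} D] {D' : Type u₄} [Category.{v₄} D']
  {D'' : Type u₅} [Category.{v₅} D'']

namespace CosliceHom

variable {F : A ⥤ C} {G : A ⥤ D} {G' : A ⥤ D'} {G'' : A ⥤ D''}

lemma Hom.restrict' {H H' : CosliceHom F G} (f : H ⟶ H') {c : C} {a : A} (h : F.obj a = c) :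
    f.nat.app c = eqToHom (by subst h; exact (H.obj_eq a).trans (H'.obj_eq a).symm) := by
  subst h
  exact f.restrict a

variable (F) in
abbrev id : CosliceHom F F := ⟨𝟭 _, rfl⟩

abbrev comp (H : CosliceHom F G) (K : CosliceHom G G') : CosliceHom F G' :=
  ⟨H.functor ⋙ K.functor, by rw [← Functor.assoc, H.w, K.w]⟩

def whiskerLeft (H : CosliceHom F G) {K K' : CosliceHom G G'} (β : K ⟶ K') :
    H.comp K ⟶ H.comp K' where
  nat := Functor.whiskerLeft H.functor β.nat
  restrict a := β.restrict' (H.obj_eq a).symm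

def whiskerRight {H H' : CosliceHom F G} (α : H ⟶ H') (K : CosliceHom G G') :
    H.comp K ⟶ H'.comp K where
  nat := Functor.whiskerRight α.nat K.functor
  restrict a := by
    simp only [Functor.whiskerRight_app, α.restrict, eqToHom_map]

def assoc (H : CosliceHom F G) (K : CosliceHom G G') (L : CosliceHom G' G'') :
    (H.comp K).comp L ≅ H.comp (K.comp L) :=
  isoMk (Functor.associator _ _ _) (fun _ => rfl)

def leftUnitor (H : CosliceHom F G) : (id F).comp H ≅ H :=
  isoMk (Functor.leftUnitor _) (fun _ => rfl)

def rightUnitor (H : CosliceHom F G) : H.comp (id G) ≅ H :=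
  isoMk (Functor.rightUnitor _) (fun _ => rfl)

@[simp]
lemma whiskerLeft_nat_app (H : CosliceHom F G) {K K' : CosliceHom G G'} (β : K ⟶ K') (c : C) :
    (Hom.nat (whiskerLeft H β)).app c = (Hom.nat β).app (H.functor.obj c) := rfl

@[simp]
lemma whiskerRight_nat_app {H H' : CosliceHom F G} (α : H ⟶ H') (K : CosliceHom G G') (c : C) :
    (Hom.nat (whiskerRight α K)).app c = K.functor.map ((Hom.nat α).app c) := rfl

@[simp]
lemma leftUnitor_hom_nat_app (H : CosliceHom F G) (c : C) :
    (Hom.nat (leftUnitor H).hom).app c = 𝟙 (H.functor.obj c) := rfl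

@[simps]
def whiskerLeftIso (H : CosliceHom F G) {K K' : CosliceHom G G'} (β : K ≅ K') :
    H.comp K ≅ H.comp K' where
  hom := whiskerLeft H β.hom
  inv := whiskerLeft H β.inv
  hom_inv_id := by
    ext c
    exact NatTrans.congr_app (congrArg Hom.nat β.hom_inv_id) _
  inv_hom_id := by
    ext c
    exact NatTrans.congr_app (congrArg Hom.nat β.inv_hom_id) _

end CosliceHom

namespace SliceHom

variable {U : C ⥤ A} {U' : D ⥤ A} {U'' : D' ⥤ A} {U₃ : D'' ⥤ A}

variable (U) in
abbrev id : SliceHom U U := ⟨𝟭 _, rfl⟩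

abbrev comp (H : SliceHom U U') (K : SliceHom U' U'') : SliceHom U U'' :=
  ⟨H.functor ⋙ K.functor, by rw [Functor.assoc, K.w, H.w]⟩

def whiskerLeft (H : SliceHom U U') {K K' : SliceHom U' U''} (β : K ⟶ K') :
    H.comp K ⟶ H.comp K' where
  nat := Functor.whiskerLeft H.functor β.nat
  proj _ := β.proj _

def whiskerRight {H H' : SliceHom U U'} (α : H ⟶ H') (K : SliceHom U' U'') :
    H.comp K ⟶ H'.comp K where
  nat := Functor.whiskerRight α.nat K.functor
  proj c := by
    have h := Functor.congr_hom K.w (α.nat.app c)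
    simp only [Functor.comp_map, α.proj] at h
    refine h.trans ?_
    simp only [eqToHom_trans]

def assoc (H : SliceHom U U') (K : SliceHom U' U'') (L : SliceHom U'' U₃) :
    (H.comp K).comp L ≅ H.comp (K.comp L) :=
  isoMk (Functor.associator _ _ _) (fun _ => CategoryTheory.Functor.map_id _ _)

def leftUnitor (H : SliceHom U U') : (id U).comp H ≅ H :=
  isoMk (Functor.leftUnitor _) (fun _ => CategoryTheory.Functor.map_id _ _)

def rightUnitor (H : SliceHom U U') : H.comp (id U') ≅ H :=
  isoMk (Functor.rightUnitor _) (fun _ => CategoryTheory.Functor.map_id _ _)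

end SliceHom

end slices

variable {T : Type u} [SmallCategory T]

/-- The Yoneda embedding is dense. -/
instance (S : Schema T) : (yon S).IsDense where
  isDenseAt I := ⟨
    { desc s := ObjectProperty.homMk
        { app r := ↾fun x => yonEquiv (s.ι.app (CostructuredArrow.mk (yonEquiv.symm x)))
          naturality r t g := by
            ext x
            let φ : CostructuredArrow.mk (Y := op t) (yonEquiv.symm (I.obj.map g x)) ⟶
                CostructuredArrow.mk (Y := op r) (yonEquiv.symm x) :=
              CostructuredArrow.homMk g.op (yonEquiv_symm_map x g).symm
            exact (congrArg yonEquiv (s.w φ)).symm.trans (yonEquiv_map _ g) }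
      fac s j := by
        apply yonEquiv.injective
        change yonEquiv (s.ι.app (CostructuredArrow.mk (yonEquiv.symm (yonEquiv (𝟙 _ ≫ j.hom))))) = _
        rw [Equiv.symm_apply_apply, Category.id_comp]
        rfl
      uniq s m hm := by
        apply ObjectProperty.hom_ext
        ext r x
        have h := hm (CostructuredArrow.mk (yonEquiv.symm x))
        have h' := congrArg yonEquiv h
        refine Eq.trans ?_ h'
        change _ = m.hom.app r (yonEquiv (𝟙 _ ≫ yonEquiv.symm x))
        rw [Category.id_comp, Equiv.apply_symm_apply]
        rfl }⟩

lemma pentagon_aux {C : Type*} [Category* C] {X Y Z W U : C} (e : Y ≅ X) (d : Z ≅ Y)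
    (b : U ≅ W) (c : W ≅ X) (a : Z ⟶ U) (h : a ≫ b.hom ≫ c.hom = d.hom ≫ e.hom) :
    e.inv ≫ d.inv ≫ a = c.inv ≫ b.inv := by
  rw [Iso.inv_comp_eq, Iso.inv_comp_eq, ← reassoc_of% h]
  simp

section

variable [HasFiniteProducts T] {R S S' S'' : Schema T}

lemma lambda_hom_ext {M : Bimodule R S} {G : Inst R ⥤ Inst S} {f g : (lambda M).functor ⟶ G}
    (h : ∀ r, (lambdaUnit M).hom.app r ≫ f.app ((yon R).obj r) =
      (lambdaUnit M).hom.app r ≫ g.app ((yon R).obj r)) : f = g := by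
  apply Functor.hom_ext_of_isLeftKanExtension _ (lambdaUnit M).hom
  ext1
  ext1 r
  exact h r

/-- A natural transformation out of `Λ_M` which restricts to the identity on types. -/
noncomputable def lambdaDesc (M : Bimodule R S) (H : CosliceHom (typeYon R) (typeYon S))
    (β : M.functor ⟶ yon R ⋙ H.functor)
    (hβ : ∀ τ, β.app ((incl R).op.obj τ) = eqToHom ((M.obj_eq τ).trans (H.obj_eq τ).symm)) :
    lambda M ⟶ H where
  nat := (lambda M).functor.descOfIsLeftKanExtension (lambdaUnit M).hom H.functor β
  restrict τ := by
    have h := (lambda M).functor.descOfIsLeftKanExtension_fac_app (lambdaUnit M).hom H.functor β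
      ((incl R).op.obj τ)
    rw [hβ, lambdaUnit_type] at h
    rw [← cancel_epi (eqToHom ((M.obj_eq τ).trans ((lambda M).obj_eq τ).symm))]
    exact h.trans (eqToHom_trans _ _).symm

@[simp]
lemma lambdaDesc_fac (M : Bimodule R S) (H : CosliceHom (typeYon R) (typeYon S))
    (β : M.functor ⟶ yon R ⋙ H.functor)
    (hβ : ∀ τ, β.app ((incl R).op.obj τ) = eqToHom ((M.obj_eq τ).trans (H.obj_eq τ).symm)) (r) :
    (lambdaUnit M).hom.app r ≫ (lambdaDesc M H β hβ).nat.app ((yon R).obj r) = β.app r :=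
  (lambda M).functor.descOfIsLeftKanExtension_fac_app (lambdaUnit M).hom H.functor β r

@[simp]
lemma lambdaDesc_fac_assoc (M : Bimodule R S) (H : CosliceHom (typeYon R) (typeYon S))
    (β : M.functor ⟶ yon R ⋙ H.functor)
    (hβ : ∀ τ, β.app ((incl R).op.obj τ) = eqToHom ((M.obj_eq τ).trans (H.obj_eq τ).symm)) (r)
    {X : Inst S} (f : H.functor.obj ((yon R).obj r) ⟶ X) :
    (lambdaUnit M).hom.app r ≫ (lambdaDesc M H β hβ).nat.app ((yon R).obj r) ≫ f = β.app r ≫ f := by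
  exact (Category.assoc _ _ _).symm.trans
    (congrArg (fun x => x ≫ f) (lambdaDesc_fac M H β hβ r))

/-- The action of `Λ` on morphisms of bimodules. -/
noncomputable def lambdaMap {M N : Bimodule R S} (φ : M ⟶ N) : lambda M ⟶ lambda N :=
  lambdaDesc M (lambda N) (φ.nat ≫ (lambdaUnit N).hom) fun τ => by
    rw [NatTrans.comp_app, lambdaUnit_type, φ.restrict]
    exact eqToHom_trans _ _

@[simp]
lemma lambdaMap_fac {M N : Bimodule R S} (φ : M ⟶ N) (r) :
    (lambdaUnit M).hom.app r ≫ (lambdaMap φ).nat.app ((yon R).obj r) =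
      φ.nat.app r ≫ (lambdaUnit N).hom.app r :=
  lambdaDesc_fac _ _ _ _ _

@[simp]
lemma lambdaMap_fac_assoc {M N : Bimodule R S} (φ : M ⟶ N) (r) {X : Inst S} (f : (lambda N).functor.obj ((yon R).obj r) ⟶ X) :
    (lambdaUnit M).hom.app r ≫ (lambdaMap φ).nat.app ((yon R).obj r) ≫ f = 
      φ.nat.app r ≫ (lambdaUnit N).hom.app r ≫ f := by
  exact (Category.assoc _ _ _).symm.trans
    ((congrArg (fun x => x ≫ f) (lambdaMap_fac φ r)).trans (Category.assoc _ _ _))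

lemma lambdaMap_id (M : Bimodule R S) : lambdaMap (𝟙 M) = 𝟙 (lambda M) := by
  ext1
  exact lambda_hom_ext fun r => by simp

lemma lambdaMap_comp {M N P : Bimodule R S} (f : M ⟶ N) (g : N ⟶ P) :
    lambdaMap (f ≫ g) = lambdaMap f ≫ lambdaMap g := by
  ext1
  exact lambda_hom_ext fun r => by simp

/-- The uniqueness of left Kan extensions, as an isomorphism of 1-cells. -/
noncomputable def lambdaIso (M : Bimodule R S) (H : CosliceHom (typeYon R) (typeYon S))
    (β : M.functor ⟶ yon R ⋙ H.functor) [H.functor.IsLeftKanExtension β]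
    (hβ : ∀ τ, β.app ((incl R).op.obj τ) = eqToHom ((M.obj_eq τ).trans (H.obj_eq τ).symm)) :
    lambda M ≅ H :=
  CosliceHom.isoMk
    { hom := (lambdaDesc M H β hβ).nat
      inv := H.functor.descOfIsLeftKanExtension β _ (lambdaUnit M).hom
      hom_inv_id := lambda_hom_ext fun r => by simp
      inv_hom_id := Functor.hom_ext_of_isLeftKanExtension _ β _ _ (by ext1; ext1 r; simp) }
    (lambdaDesc M H β hβ).restrict

@[simp]
lemma lambdaIso_fac (M : Bimodule R S) (H : CosliceHom (typeYon R) (typeYon S))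
    (β : M.functor ⟶ yon R ⋙ H.functor) [H.functor.IsLeftKanExtension β]
    (hβ : ∀ τ, β.app ((incl R).op.obj τ) = eqToHom ((M.obj_eq τ).trans (H.obj_eq τ).symm)) (r) :
    (lambdaUnit M).hom.app r ≫ (lambdaIso M H β hβ).hom.nat.app ((yon R).obj r) = β.app r :=
  lambdaDesc_fac M H β hβ r

/-- The unit bimodule. -/
abbrev unitBimodule (S : Schema T) : Bimodule S S := ⟨yon S, rfl⟩

/-- The isomorphism `Λ_y ≅ id`. -/
noncomputable def lambdaId (S : Schema T) :
    lambda (unitBimodule S) ≅ CosliceHom.id (typeYon S) :=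
  haveI : Functor.IsLeftKanExtension (F := (unitBimodule S).functor) (L := yon S)
      (CosliceHom.id (typeYon S)).functor (yon S).rightUnitor.inv :=
    inferInstanceAs ((𝟭 (Inst S)).IsLeftKanExtension (yon S).rightUnitor.inv)
  lambdaIso (unitBimodule S) (CosliceHom.id _) (yon S).rightUnitor.inv fun _ => rfl

@[simp]
lemma lambdaId_fac (S : Schema T) (r) :
    (lambdaUnit (unitBimodule S)).hom.app r ≫ (lambdaId S).hom.nat.app ((yon S).obj r) = 𝟙 _ :=
  lambdaDesc_fac (unitBimodule S) (CosliceHom.id _) (yon S).rightUnitor.inv (fun _ => rfl) r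

instance (M : Bimodule R S) (N : Bimodule S S') :
    ((lambda M).comp (lambda N)).functor.IsLeftKanExtension (F := (M.comp (lambda N)).functor)
      (L := yon R) (Functor.whiskerRight (lambdaUnit M).hom (lambda N).functor) := by
  have : PreservesColimitsOfSize.{u, u} (lambda N).functor :=
    (lambdaAdj N).leftAdjoint_preservesColimits
  exact Functor.PreservesLeftKanExtension.preserves (G := (lambda N).functor) (F := M.functor)
    (L := yon R) _ (lambdaUnit M).hom

/-- The isomorphism `Λ_{Λ_N ∘ M} ≅ Λ_N ∘ Λ_M`. -/
noncomputable def lambdaComp (M : Bimodule R S) (N : Bimodule S S') :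
    lambda (M.comp (lambda N)) ≅ (lambda M).comp (lambda N) :=
  lambdaIso (M.comp (lambda N)) ((lambda M).comp (lambda N))
    (Functor.whiskerRight (lambdaUnit M).hom (lambda N).functor) fun τ => by
      rw [Functor.whiskerRight_app, lambdaUnit_type]
      exact eqToHom_map _ _

@[simp]
lemma lambdaComp_fac (M : Bimodule R S) (N : Bimodule S S') (r) :
    (lambdaUnit (M.comp (lambda N))).hom.app r ≫
      (lambdaComp M N).hom.nat.app ((yon R).obj r) =
      (lambda N).functor.map ((lambdaUnit M).hom.app r) :=
  lambdaIso_fac (M.comp (lambda N)) ((lambda M).comp (lambda N))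
    (Functor.whiskerRight (lambdaUnit M).hom (lambda N).functor) _ r

@[simp]
lemma lambdaComp_fac_assoc (M : Bimodule R S) (N : Bimodule S S') (r) {X : Inst S'} (f : (lambda N).functor.obj ((lambda M).functor.obj ((yon R).obj r)) ⟶ X) :
    (lambdaUnit (M.comp (lambda N))).hom.app r ≫
      (lambdaComp M N).hom.nat.app ((yon R).obj r) ≫ f = (lambda N).functor.map ((lambdaUnit M).hom.app r) ≫ f := by
  exact (Category.assoc _ _ _).symm.trans
    (congrArg (fun x => x ≫ f) (lambdaComp_fac M N r))

lemma lambdaComp_whiskerLeft (M : Bimodule R S) {N N' : Bimodule S S'} (φ : N ⟶ N') :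
    lambdaMap (CosliceHom.whiskerLeft M (lambdaMap φ)) ≫ (lambdaComp M N').hom =
      (lambdaComp M N).hom ≫ CosliceHom.whiskerLeft (lambda M) (lambdaMap φ) := by
  ext1
  refine lambda_hom_ext fun r => ?_
  simp only [CosliceHom.comp_nat_app, lambdaMap_fac_assoc, lambdaComp_fac,
    CosliceHom.whiskerLeft_nat_app]
  refine Eq.trans ?_ (lambdaComp_fac_assoc M N r _).symm
  exact ((lambdaMap φ).nat.naturality ((lambdaUnit M).hom.app r)).symm

lemma lambdaComp_whiskerRight {M M' : Bimodule R S} (θ : M ⟶ M') (N : Bimodule S S') :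
    lambdaMap (CosliceHom.whiskerRight θ (lambda N)) ≫ (lambdaComp M' N).hom =
      (lambdaComp M N).hom ≫ CosliceHom.whiskerRight (lambdaMap θ) (lambda N) := by
  ext1
  refine lambda_hom_ext fun r => ?_
  simp only [CosliceHom.comp_nat_app, lambdaMap_fac_assoc, lambdaComp_fac,
    CosliceHom.whiskerRight_nat_app]
  refine Eq.trans ?_ (lambdaComp_fac_assoc M N r _).symm
  refine (Functor.map_comp _ _ _).symm.trans (Eq.trans ?_ (Functor.map_comp _ _ _))
  rw [lambdaMap_fac]

/-- The associator of bimodules. -/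
noncomputable def bimoduleAssoc (M : Bimodule R S) (N : Bimodule S S') (P : Bimodule S' S'') :
    (M.comp (lambda N)).comp (lambda P) ≅ M.comp (lambda (N.comp (lambda P))) :=
  CosliceHom.assoc M (lambda N) (lambda P) ≪≫ CosliceHom.whiskerLeftIso M (lambdaComp N P).symm

lemma bimoduleAssoc_hom_app (M : Bimodule R S) (N : Bimodule S S') (P : Bimodule S' S'') (r) :
    (bimoduleAssoc M N P).hom.nat.app r = (lambdaComp N P).inv.nat.app (M.functor.obj r) :=
  Category.id_comp _

lemma bimoduleAssoc_inv_app (M : Bimodule R S) (N : Bimodule S S') (P : Bimodule S' S'') (r) :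
    (bimoduleAssoc M N P).inv.nat.app r = (lambdaComp N P).hom.nat.app (M.functor.obj r) :=
  Category.comp_id _

/-- The left unitor of bimodules. -/
noncomputable def bimoduleLeftUnitor (M : Bimodule R S) :
    (unitBimodule R).comp (lambda M) ≅ M :=
  (CosliceHom.isoMk (H' := (unitBimodule R).comp (lambda M)) (lambdaUnit M)
    (lambdaUnit_type M)).symm

/-- The right unitor of bimodules. -/
noncomputable def bimoduleRightUnitor (M : Bimodule R S) :
    M.comp (lambda (unitBimodule S)) ≅ M :=
  CosliceHom.whiskerLeftIso M (lambdaId S) ≪≫ CosliceHom.rightUnitor M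

lemma bimoduleLeftUnitor_hom_app (M : Bimodule R S) (r) :
    (bimoduleLeftUnitor M).hom.nat.app r = (lambdaUnit M).inv.app r := rfl

lemma bimoduleLeftUnitor_inv_app (M : Bimodule R S) (r) :
    (bimoduleLeftUnitor M).inv.nat.app r = (lambdaUnit M).hom.app r := rfl

lemma bimoduleRightUnitor_hom_app (M : Bimodule R S) (r) :
    (bimoduleRightUnitor M).hom.nat.app r = (lambdaId S).hom.nat.app (M.functor.obj r) :=
  Category.comp_id _

lemma bimoduleRightUnitor_inv_app (M : Bimodule R S) (r) :
    (bimoduleRightUnitor M).inv.nat.app r = (lambdaId S).inv.nat.app (M.functor.obj r) :=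
  Category.id_comp _

lemma lambdaComp_assoc (M : Bimodule R S) (N : Bimodule S S') (P : Bimodule S' S'') :
    lambdaMap (bimoduleAssoc M N P).hom ≫ (lambdaComp M (N.comp (lambda P))).hom ≫
      CosliceHom.whiskerLeft (lambda M) (lambdaComp N P).hom =
    (lambdaComp (M.comp (lambda N)) P).hom ≫
      CosliceHom.whiskerRight (lambdaComp M N).hom (lambda P) ≫
      (CosliceHom.assoc (lambda M) (lambda N) (lambda P)).hom := by
  ext1
  refine lambda_hom_ext fun r => ?_
  simp only [CosliceHom.comp_nat_app, lambdaMap_fac_assoc,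
    CosliceHom.whiskerRight_nat_app, CosliceHom.whiskerLeft_nat_app]
  refine (congrArg (fun x => _ ≫ x) (lambdaComp_fac_assoc M _ r _)).trans ?_
  refine Eq.trans ?_ (lambdaComp_fac_assoc (M.comp (lambda N)) P r _).symm
  have h1 := (lambdaComp N P).hom.nat.naturality ((lambdaUnit M).hom.app r)
  have h2 := congrArg (fun x => (lambda P).functor.map x) (lambdaComp_fac M N r)
  rw [Functor.map_comp] at h2
  refine (congrArg (fun x => _ ≫ x) h1).trans ?_
  rw [bimoduleAssoc_hom_app, CosliceHom.inv_hom_app_assoc]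
  refine h2.symm.trans (congrArg (fun x => _ ≫ x) ?_)
  exact (Category.comp_id _).symm

lemma lambdaComp_leftUnitor (M : Bimodule R S) :
    lambdaMap (bimoduleLeftUnitor M).hom = (lambdaComp (unitBimodule R) M).hom ≫
      CosliceHom.whiskerRight (lambdaId R).hom (lambda M) ≫
      (CosliceHom.leftUnitor (lambda M)).hom := by
  ext1
  refine lambda_hom_ext fun r => ?_
  simp only [CosliceHom.comp_nat_app, lambdaMap_fac,
    CosliceHom.whiskerRight_nat_app, CosliceHom.leftUnitor_hom_nat_app]
  refine Eq.trans ?_ (lambdaComp_fac_assoc (unitBimodule R) M r _).symm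
  have h2 := congrArg (fun x => (lambda M).functor.map x) (lambdaId_fac R r)
  rw [Functor.map_comp] at h2
  rw [bimoduleLeftUnitor_hom_app]
  refine ((lambdaUnit M).inv_hom_id_app r).trans ?_
  refine Eq.trans ?_ (congrArg (fun x => _ ≫ x) (Category.comp_id _).symm)
  exact ((lambda M).functor.map_id _).symm.trans h2.symm

end

/-- The objects of the horizontal bicategory of `Data`: schemas. -/
structure HorData (T : Type u) [SmallCategory T] where
  schema : Schema T

open CosliceHom in
/-- The horizontal bicategory of `Data`: 1-cells `R ⟶ S` are bimodules, the composite of `M : R ⇸ S` and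
`N : S ⇸ S'` is `Λ_N ∘ M`, the units are the Yoneda embeddings, and 2-cells are morphisms of bimodules. -/
noncomputable instance [HasFiniteProducts T] : Bicategory (HorData T) where
  Hom R S := Bimodule R.schema S.schema
  id S := unitBimodule S.schema
  comp M N := M.comp (lambda N)
  whiskerLeft M _ _ φ := whiskerLeft M (lambdaMap φ)
  whiskerRight θ N := whiskerRight θ (lambda N)
  associator M N P := bimoduleAssoc M N P
  leftUnitor M := bimoduleLeftUnitor M
  rightUnitor M := bimoduleRightUnitor M
  whiskerLeft_id M N := by
    refine hom_ext (NatTrans.ext (funext fun r => ?_))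
    simp [lambdaMap_id]
  whiskerLeft_comp M _ _ _ φ ψ := by
    refine hom_ext (NatTrans.ext (funext fun r => ?_))
    simp [lambdaMap_comp]
  id_whiskerLeft {R S} M N φ := by
    refine hom_ext (NatTrans.ext (funext fun r => ?_))
    simp only [comp_nat_app, bimoduleLeftUnitor_hom_app, bimoduleLeftUnitor_inv_app]
    rw [← lambdaMap_fac]
    exact (Iso.inv_hom_id_app_assoc _ _ _).symm
  comp_whiskerLeft M N _ _ φ := by
    refine hom_ext (NatTrans.ext (funext fun r => ?_))
    simp only [comp_nat_app, bimoduleAssoc_hom_app, bimoduleAssoc_inv_app, whiskerLeft_nat_app]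
    have h := NatTrans.congr_app (congrArg Hom.nat (lambdaComp_whiskerLeft N φ)) (M.functor.obj r)
    exact ((congrArg (fun x => _ ≫ x) h).trans (inv_hom_app_assoc _ _ _)).symm
  id_whiskerRight M N := by
    refine hom_ext (NatTrans.ext (funext fun r => ?_))
    exact (lambda N).functor.map_id _
  comp_whiskerRight θ θ' N := by
    refine hom_ext (NatTrans.ext (funext fun r => ?_))
    exact (lambda N).functor.map_comp _ _
  whiskerRight_id θ := by
    refine hom_ext (NatTrans.ext (funext fun r => ?_))
    simp only [comp_nat_app, bimoduleRightUnitor_hom_app, bimoduleRightUnitor_inv_app,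
      whiskerRight_nat_app]
    have h := (lambdaId _).hom.nat.naturality (θ.nat.app r)
    refine Eq.trans ?_ (congrArg (fun x => x ≫ _) h |>.trans (Category.assoc _ _ _))
    refine Eq.trans ?_ (Category.assoc _ _ _).symm
    refine Eq.trans ?_ (congrArg (fun x => _ ≫ x) (hom_inv_app _ _).symm)
    exact (Category.comp_id _).symm
  whiskerRight_comp θ N P := by
    refine hom_ext (NatTrans.ext (funext fun r => ?_))
    simp only [comp_nat_app, bimoduleAssoc_hom_app, bimoduleAssoc_inv_app, whiskerRight_nat_app]
    have h := (lambdaComp N P).hom.nat.naturality (θ.nat.app r)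
    refine Eq.trans ?_ (congrArg (fun x => x ≫ _) h |>.trans (Category.assoc _ _ _))
    refine Eq.trans ?_ (Category.assoc _ _ _).symm
    refine Eq.trans ?_ (congrArg (fun x => _ ≫ x) (hom_inv_app _ _).symm)
    exact (Category.comp_id _).symm
  whisker_assoc M _ _ θ N := by
    refine hom_ext (NatTrans.ext (funext fun r => ?_))
    simp only [comp_nat_app, bimoduleAssoc_hom_app, bimoduleAssoc_inv_app, whiskerRight_nat_app,
      whiskerLeft_nat_app]
    have h := NatTrans.congr_app (congrArg Hom.nat (lambdaComp_whiskerRight θ N)) (M.functor.obj r)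
    exact ((congrArg (fun x => _ ≫ x) h).trans (inv_hom_app_assoc _ _ _)).symm
  whisker_exchange {_ _ _ f g h i} η θ := by
    refine hom_ext (NatTrans.ext (funext fun r => ?_))
    exact (lambdaMap θ).nat.naturality (η.nat.app r) |>.symm
  pentagon M N P Q := by
    refine hom_ext (NatTrans.ext (funext fun r => ?_))
    simp only [comp_nat_app, bimoduleAssoc_hom_app, whiskerRight_nat_app, whiskerLeft_nat_app]
    have h := NatTrans.congr_app (congrArg Hom.nat (lambdaComp_assoc N P Q)) (M.functor.obj r)
    exact pentagon_aux ((lambda Q).functor.mapIso (appIso (lambdaComp N P) (M.functor.obj r)))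
      (appIso (lambdaComp (N.comp (lambda P)) Q) (M.functor.obj r))
      (appIso (lambdaComp N (P.comp (lambda Q))) (M.functor.obj r))
      (appIso (lambdaComp P Q) ((lambda N).functor.obj (M.functor.obj r))) _
      (h.trans (congrArg (fun x => _ ≫ x) (Category.comp_id _)))
  triangle M N := by
    refine hom_ext (NatTrans.ext (funext fun r => ?_))
    simp only [comp_nat_app, bimoduleAssoc_hom_app, bimoduleRightUnitor_hom_app,
      whiskerRight_nat_app, whiskerLeft_nat_app]
    have h := NatTrans.congr_app (congrArg Hom.nat (lambdaComp_leftUnitor N)) (M.functor.obj r)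
    refine (congrArg (fun x => _ ≫ x) h).trans ((inv_hom_app_assoc _ _ _).trans ?_)
    exact Category.comp_id _

/-- The 1-cells under `Tᵒᵖ` between categories of instances which are left adjoints. -/
def isLeftAdj (R S : Schema T) : ObjectProperty (CosliceHom (typeYon R) (typeYon S)) :=
  fun H => H.functor.IsLeftAdjoint

/-- The 1-cells over `Alg T` between categories of instances which are right adjoints. -/
def isRightAdj (R S : Schema T) : ObjectProperty (SliceHom (restr R) (restr S)) :=
  fun H => H.functor.IsRightAdjoint

/-- The objects of the 2-category of type-preserving left adjoints: the categories `Inst S`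
under `Tᵒᵖ`, indexed by the schemas `S`. -/
structure LAdjType (T : Type u) [SmallCategory T] where
  schema : Schema T

/-- The objects of the 2-category of type-preserving right adjoints: the categories `Inst S`
over `Alg T`, indexed by the schemas `S`. -/
structure RAdjType (T : Type u) [SmallCategory T] where
  schema : Schema T

/-- The 2-category of type-preserving left adjoints, locally full in the coslice 2-category of
categories under `Tᵒᵖ`. -/
instance : Bicategory (LAdjType T) where
  Hom R S := (isLeftAdj R.schema S.schema).FullSubcategory
  id S := ⟨CosliceHom.id _, inferInstanceAs (𝟭 _).IsLeftAdjoint⟩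
  comp H K := ⟨H.obj.comp K.obj, by
    have h := H.property
    have k := K.property
    unfold isLeftAdj at h k ⊢
    infer_instance⟩
  homCategory R S := inferInstanceAs (Category (isLeftAdj R.schema S.schema).FullSubcategory)
  whiskerLeft {R S S'} H K K' β := ObjectProperty.homMk (P := isLeftAdj R.schema S'.schema)
    (CosliceHom.whiskerLeft H.obj (InducedCategory.Hom.hom β))
  whiskerRight {R S S' H H'} α K := ObjectProperty.homMk (P := isLeftAdj R.schema S'.schema)
    (CosliceHom.whiskerRight (InducedCategory.Hom.hom α) K.obj)
  associator {R S S' S''} H K L := ObjectProperty.isoMk (isLeftAdj R.schema S''.schema)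
    (CosliceHom.assoc H.obj K.obj L.obj)
  leftUnitor {R S} H := (isLeftAdj R.schema S.schema).isoMk
    (X := ⟨(CosliceHom.id (typeYon R.schema)).comp H.obj, _⟩) (Y := H) (CosliceHom.leftUnitor H.obj)
  rightUnitor {R S} H := (isLeftAdj R.schema S.schema).isoMk
    (X := ⟨H.obj.comp (CosliceHom.id (typeYon S.schema)), _⟩) (Y := H) (CosliceHom.rightUnitor H.obj)
  whiskerLeft_id H K := by
    refine ObjectProperty.hom_ext _ (CosliceHom.hom_ext (NatTrans.ext (funext fun c => ?_)))
    rfl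
  whiskerLeft_comp H _ _ _ β γ := by
    refine ObjectProperty.hom_ext _ (CosliceHom.hom_ext (NatTrans.ext (funext fun c => ?_)))
    rfl
  id_whiskerLeft β := by
    refine ObjectProperty.hom_ext _ (CosliceHom.hom_ext (NatTrans.ext (funext fun c => ?_)))
    exact ((Category.id_comp _).trans (Category.comp_id _)).symm
  comp_whiskerLeft H K _ _ β := by
    refine ObjectProperty.hom_ext _ (CosliceHom.hom_ext (NatTrans.ext (funext fun c => ?_)))
    exact ((Category.id_comp _).trans (Category.comp_id _)).symm
  id_whiskerRight H K := by
    refine ObjectProperty.hom_ext _ (CosliceHom.hom_ext (NatTrans.ext (funext fun c => ?_)))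
    exact K.obj.functor.map_id _
  comp_whiskerRight α β K := by
    refine ObjectProperty.hom_ext _ (CosliceHom.hom_ext (NatTrans.ext (funext fun c => ?_)))
    exact K.obj.functor.map_comp _ _
  whiskerRight_id α := by
    refine ObjectProperty.hom_ext _ (CosliceHom.hom_ext (NatTrans.ext (funext fun c => ?_)))
    exact ((Category.id_comp _).trans (Category.comp_id _)).symm
  whiskerRight_comp α H K := by
    refine ObjectProperty.hom_ext _ (CosliceHom.hom_ext (NatTrans.ext (funext fun c => ?_)))
    exact ((Category.id_comp _).trans (Category.comp_id _)).symm
  whisker_assoc H _ _ α K := by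
    refine ObjectProperty.hom_ext _ (CosliceHom.hom_ext (NatTrans.ext (funext fun c => ?_)))
    exact ((Category.id_comp _).trans (Category.comp_id _)).symm
  whisker_exchange {_ _ _ _ _ _ _} α β := by
    refine ObjectProperty.hom_ext _ (CosliceHom.hom_ext (NatTrans.ext (funext fun c => ?_)))
    exact (β.hom.nat.naturality (α.hom.nat.app c)).symm
  pentagon H K L M := by
    refine ObjectProperty.hom_ext _ (CosliceHom.hom_ext (NatTrans.ext (funext fun c => ?_)))
    exact (congrArg (fun x => x ≫ _) (M.obj.functor.map_id _)).trans (congrArg (fun x => _ ≫ x) (Category.id_comp _))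
  triangle H K := by
    refine ObjectProperty.hom_ext _ (CosliceHom.hom_ext (NatTrans.ext (funext fun c => ?_)))
    exact (Category.id_comp _).trans (K.obj.functor.map_id _).symm

/-- The 2-category of type-preserving right adjoints, locally full in the slice 2-category of
categories over `Alg T`. -/
instance : Bicategory (RAdjType T) where
  Hom R S := (isRightAdj R.schema S.schema).FullSubcategory
  id S := ⟨SliceHom.id _, inferInstanceAs (𝟭 _).IsRightAdjoint⟩
  comp H K := ⟨H.obj.comp K.obj, by
    have h := H.property
    have k := K.property
    unfold isRightAdj at h k ⊢
    infer_instance⟩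
  homCategory R S := inferInstanceAs (Category (isRightAdj R.schema S.schema).FullSubcategory)
  whiskerLeft {R S S'} H K K' β := ObjectProperty.homMk (P := isRightAdj R.schema S'.schema)
    (SliceHom.whiskerLeft H.obj (InducedCategory.Hom.hom β))
  whiskerRight {R S S' H H'} α K := ObjectProperty.homMk (P := isRightAdj R.schema S'.schema)
    (SliceHom.whiskerRight (InducedCategory.Hom.hom α) K.obj)
  associator {R S S' S''} H K L := ObjectProperty.isoMk (isRightAdj R.schema S''.schema)
    (SliceHom.assoc H.obj K.obj L.obj)
  leftUnitor {R S} H := (isRightAdj R.schema S.schema).isoMk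
    (X := ⟨(SliceHom.id (restr R.schema)).comp H.obj, _⟩) (Y := H) (SliceHom.leftUnitor H.obj)
  rightUnitor {R S} H := (isRightAdj R.schema S.schema).isoMk
    (X := ⟨H.obj.comp (SliceHom.id (restr S.schema)), _⟩) (Y := H) (SliceHom.rightUnitor H.obj)
  whiskerLeft_id H K := by
    refine ObjectProperty.hom_ext _ (SliceHom.hom_ext (NatTrans.ext (funext fun c => ?_)))
    rfl
  whiskerLeft_comp H _ _ _ β γ := by
    refine ObjectProperty.hom_ext _ (SliceHom.hom_ext (NatTrans.ext (funext fun c => ?_)))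
    rfl
  id_whiskerLeft β := by
    refine ObjectProperty.hom_ext _ (SliceHom.hom_ext (NatTrans.ext (funext fun c => ?_)))
    exact ((Category.id_comp _).trans (Category.comp_id _)).symm
  comp_whiskerLeft H K _ _ β := by
    refine ObjectProperty.hom_ext _ (SliceHom.hom_ext (NatTrans.ext (funext fun c => ?_)))
    exact ((Category.id_comp _).trans (Category.comp_id _)).symm
  id_whiskerRight H K := by
    refine ObjectProperty.hom_ext _ (SliceHom.hom_ext (NatTrans.ext (funext fun c => ?_)))
    exact K.obj.functor.map_id _
  comp_whiskerRight α β K := by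
    refine ObjectProperty.hom_ext _ (SliceHom.hom_ext (NatTrans.ext (funext fun c => ?_)))
    exact K.obj.functor.map_comp _ _
  whiskerRight_id α := by
    refine ObjectProperty.hom_ext _ (SliceHom.hom_ext (NatTrans.ext (funext fun c => ?_)))
    exact ((Category.id_comp _).trans (Category.comp_id _)).symm
  whiskerRight_comp α H K := by
    refine ObjectProperty.hom_ext _ (SliceHom.hom_ext (NatTrans.ext (funext fun c => ?_)))
    exact ((Category.id_comp _).trans (Category.comp_id _)).symm
  whisker_assoc H _ _ α K := by
    refine ObjectProperty.hom_ext _ (SliceHom.hom_ext (NatTrans.ext (funext fun c => ?_)))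
    exact ((Category.id_comp _).trans (Category.comp_id _)).symm
  whisker_exchange {_ _ _ _ _ _ _} α β := by
    refine ObjectProperty.hom_ext _ (SliceHom.hom_ext (NatTrans.ext (funext fun c => ?_)))
    exact (β.hom.nat.naturality (α.hom.nat.app c)).symm
  pentagon H K L M := by
    refine ObjectProperty.hom_ext _ (SliceHom.hom_ext (NatTrans.ext (funext fun c => ?_)))
    exact (congrArg (fun x => x ≫ _) (M.obj.functor.map_id _)).trans (congrArg (fun x => _ ≫ x) (Category.id_comp _))
  triangle H K := by
    refine ObjectProperty.hom_ext _ (SliceHom.hom_ext (NatTrans.ext (funext fun c => ?_)))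
    exact (Category.id_comp _).trans (K.obj.functor.map_id _).symm

section bicategories

universe w v w' v' u'

/-- The bidual of a bicategory, obtained by reversing both 1-cells and 2-cells. -/
structure Coop (B : Type u') where
  unop : B

open Bicategory in
instance {B : Type u'} [Bicategory.{w, v} B] : Bicategory (Coop B) where
  Hom a b := (b.unop ⟶ a.unop)ᵒᵖ
  id a := op (𝟙 a.unop)
  comp f g := op (g.unop ≫ f.unop)
  homCategory a b := inferInstanceAs (Category (b.unop ⟶ a.unop)ᵒᵖ)
  whiskerLeft {a b c} f g h η := Quiver.Hom.op (V := c.unop ⟶ a.unop)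
    (Quiver.Hom.unop (V := c.unop ⟶ b.unop) η ▷ f.unop)
  whiskerRight {a b c g h} η f := Quiver.Hom.op (V := c.unop ⟶ a.unop)
    (f.unop ◁ Quiver.Hom.unop (V := b.unop ⟶ a.unop) η)
  associator f g h := (α_ h.unop g.unop f.unop).op
  leftUnitor f := (ρ_ f.unop).symm.op
  rightUnitor f := (λ_ f.unop).symm.op
  whiskerLeft_id f g := Quiver.Hom.unop_inj (id_whiskerRight g.unop f.unop)
  whiskerLeft_comp f _ _ _ η θ := Quiver.Hom.unop_inj (comp_whiskerRight _ _ _)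
  id_whiskerLeft η := Quiver.Hom.unop_inj
    ((whiskerRight_id _).trans (Category.assoc _ _ _).symm)
  comp_whiskerLeft _ _ _ _ _ := Quiver.Hom.unop_inj
    ((whiskerRight_comp _ _ _).trans (Category.assoc _ _ _).symm)
  id_whiskerRight f g := Quiver.Hom.unop_inj (whiskerLeft_id g.unop f.unop)
  comp_whiskerRight _ _ _ := Quiver.Hom.unop_inj (whiskerLeft_comp _ _ _)
  whiskerRight_id η := Quiver.Hom.unop_inj
    ((id_whiskerLeft _).trans (Category.assoc _ _ _).symm)
  whiskerRight_comp _ _ _ := Quiver.Hom.unop_inj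
    ((comp_whiskerLeft _ _ _).trans (Category.assoc _ _ _).symm)
  whisker_assoc _ _ _ _ _ := Quiver.Hom.unop_inj
    ((whisker_assoc_symm _ _ _).trans (Category.assoc _ _ _).symm)
  whisker_exchange η θ := Quiver.Hom.unop_inj (whisker_exchange _ _)
  pentagon f g h i := Quiver.Hom.unop_inj
    ((Category.assoc _ _ _).trans (pentagon i.unop h.unop g.unop f.unop))
  triangle f g := Quiver.Hom.unop_inj (triangle_assoc_comp_right_inv  g.unop f.unop)

end bicategories

section bicategories

universe w v w' v' u' u₁

variable {B : Type u'} [Bicategory.{w, v} B] {C : Type u₁} [Bicategory.{w', v'} C]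

variable (B C) in
/-- The data of a pseudofunctor, without the coherence conditions on the constraint
isomorphisms. -/
structure PseudofunctorData extends PrelaxFunctor B C where
  mapId (a : B) : map (𝟙 a) ≅ 𝟙 (obj a)
  mapComp {a b c : B} (f : a ⟶ b) (g : b ⟶ c) : map (f ≫ g) ≅ map f ≫ map g

/-- The data of a pseudofunctor. -/
def dataOf (F : Pseudofunctor B C) : PseudofunctorData B C where
  toPrelaxFunctor := F.toPrelaxFunctor
  mapId := F.mapId
  mapComp := F.mapComp

/-- A pseudofunctor is a local equivalence if its action on every category of 1-cells is an
equivalence of categories. -/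
def IsLocalEquivalence (F : Pseudofunctor B C) : Prop :=
  ∀ a b : B, (F.mapFunctor a b).IsEquivalence

/-- A pseudofunctor is an equivalence of bicategories if it is a local equivalence and every
object of the target is equivalent to a value of it. -/
def IsBiequivalence (F : Pseudofunctor B C) : Prop :=
  IsLocalEquivalence F ∧ ∀ c : C, ∃ b : B, Nonempty (Bicategory.Equivalence (F.obj b) c)

end bicategories

lemma eqToHom_aux₄ {C : Type*} [Category* C] {X Y Z W : C} (a : X = Y) (b : Y = Z) (c : Z = X)
    (f : X ⟶ W) : eqToHom a ≫ eqToHom b ≫ eqToHom c ≫ f = f := by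
  subst a b; simp

lemma eqToHom_aux₅ {C : Type*} [Category* C] {X Y Z W : C} (a : X = Y) (b : Y = Z) (c : X = Z)
    (f : Z ⟶ W) : eqToHom a ≫ eqToHom b ≫ f = eqToHom c ≫ f := by
  subst a b; simp

variable {T : Type u} [SmallCategory T]

section gammaMap

variable {R S : Schema T} {M N : Bimodule R S} (φ : M ⟶ N)

/-- Precomposition with a morphism of bimodules. -/
def nervePre : nerve N.functor ⟶ nerve M.functor where
  app J :=
    { app r := ↾fun f => φ.nat.app (op r) ≫ f
      naturality r s g := by
        ext f
        exact ((φ.nat.naturality_assoc g.op f).symm : φ.nat.app (op s) ≫ N.functor.map g.op ≫ f =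
          M.functor.map g.op ≫ φ.nat.app (op r) ≫ f) }
  naturality J J' g := by
    ext r f
    exact (Category.assoc _ _ _).symm

/-- The natural transformation `Γ_N ⟶ Γ_M` given by precomposition with `φ : M ⟶ N`. -/
def gammaMapNat : gammaFunctor N ⟶ gammaFunctor M where
  app J := ObjectProperty.homMk
    ((gammaFunctorIso N).hom.app J ≫ (nervePre φ).app J ≫ (gammaFunctorIso M).inv.app J)
  naturality J J' f := ObjectProperty.hom_ext _
    (((gammaFunctorIso N).hom ≫ nervePre φ ≫ (gammaFunctorIso M).inv).naturality f)

lemma gammaMapNat_app_type (J : Inst S) (τ : T) :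
    ((gammaMapNat φ).app J).hom.app (.ty τ) = 𝟙 (J.obj.obj (.ty τ)) := by
  ext x
  change yonEquiv (eqToHom (M.obj_eq (op τ)).symm ≫ φ.nat.app (op (.ty τ)) ≫
    eqToHom (N.obj_eq (op τ)) ≫ yonEquiv.symm x) = x
  have h := φ.restrict (op τ)
  refine (congrArg (fun y => yonEquiv (_ ≫ y ≫ _)) h).trans ?_
  refine Eq.trans (congrArg yonEquiv ?_) ((yonEquiv (S := S) (r := .ty τ) (I := J)).apply_symm_apply x)
  exact eqToHom_aux₄ _ _ _ _

/-- The action of `Γ` on morphisms of bimodules. -/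
def gammaMap : gamma N ⟶ gamma M where
  nat := gammaMapNat φ
  proj J := by
    apply ObjectProperty.hom_ext
    ext1
    ext1 τ
    rw [alg_eqToHom_app]
    exact gammaMapNat_app_type φ J τ

end gammaMap

lemma gammaMap_id {R S : Schema T} (M : Bimodule R S) : gammaMap (𝟙 M) = 𝟙 (gamma M) := by
  refine SliceHom.hom_ext (NatTrans.ext (funext fun J => ObjectProperty.hom_ext _ ?_))
  have h : (nervePre (𝟙 M)).app J = 𝟙 _ := by
    ext r x
    exact Category.id_comp _
  change (gammaFunctorIso M).hom.app J ≫ (nervePre (𝟙 M)).app J ≫ (gammaFunctorIso M).inv.app J = _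
  rw [h, Category.id_comp]
  exact (gammaFunctorIso M).hom_inv_id_app J

lemma gammaMap_comp {R S : Schema T} {M N P : Bimodule R S} (φ : M ⟶ N) (ψ : N ⟶ P) :
    gammaMap (φ ≫ ψ) = gammaMap ψ ≫ gammaMap φ := by
  refine SliceHom.hom_ext (NatTrans.ext (funext fun J => ObjectProperty.hom_ext _ ?_))
  have h : (nervePre (φ ≫ ψ)).app J = (nervePre ψ).app J ≫ (nervePre φ).app J := by
    ext r x
    exact Category.assoc _ _ _
  change (gammaFunctorIso P).hom.app J ≫ (nervePre (φ ≫ ψ)).app J ≫ (gammaFunctorIso M).inv.app J =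
    ((gammaFunctorIso P).hom.app J ≫ (nervePre ψ).app J ≫ (gammaFunctorIso N).inv.app J) ≫
    ((gammaFunctorIso N).hom.app J ≫ (nervePre φ).app J ≫ (gammaFunctorIso M).inv.app J)
  rw [h]
  simp

/-- An adjunction between a 1-cell `L` under `Tᵒᵖ` and a 1-cell `G` over `Alg T` which is compatible
with types: if `f : y τ ⟶ G J` corresponds to `f' : y τ = L (y τ) ⟶ J`, then the elements of
`(G J) τ = J τ` given by `f` and `f'` under the Yoneda lemma agree. -/
structure TypeAdjunction {R S : Schema T} (L : CosliceHom (typeYon R) (typeYon S))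
    (G : SliceHom (restr S) (restr R)) where
  adj : L.functor ⊣ G.functor
  compat : ∀ (τ : T) (J : Inst S) (f : (typeYon R).obj (op τ) ⟶ G.functor.obj J),
    (eqToHom (G.obj_eq J)).hom.app τ (yonEquiv f) =
      yonEquiv (eqToHom (L.obj_eq (op τ)).symm ≫ (adj.homEquiv _ _).symm f)

namespace TypeAdjunction

variable {R S S' : Schema T} {L L' L'' : CosliceHom (typeYon R) (typeYon S)}
  {G G' G'' : SliceHom (restr S) (restr R)}

lemma mate_proj (a : TypeAdjunction L G) (a' : TypeAdjunction L' G') (α : L ⟶ L') (J : Inst S) :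
    (restr R).map ((conjugateEquiv a'.adj a.adj α.nat).app J) =
      eqToHom ((G'.obj_eq J).trans (G.obj_eq J).symm) := by
  rw [← cancel_mono (eqToHom (G.obj_eq J)), eqToHom_trans]
  apply ObjectProperty.hom_ext
  ext τ x
  obtain ⟨f, rfl⟩ : ∃ f : (typeYon R).obj (op τ) ⟶ G'.functor.obj J, yonEquiv f = x :=
    ⟨yonEquiv.symm x, Equiv.apply_symm_apply _ _⟩
  refine Eq.trans ?_ (a'.compat τ J f).symm
  refine (a.compat τ J (f ≫ (conjugateEquiv a'.adj a.adj α.nat).app J)).trans ?_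
  have h := α.restrict (op τ)
  have h2 : (a.adj.homEquiv _ _).symm (f ≫ (conjugateEquiv a'.adj a.adj α.nat).app J) =
      α.nat.app _ ≫ (a'.adj.homEquiv _ _).symm f := by
    rw [Adjunction.homEquiv_counit, Adjunction.homEquiv_counit, Functor.map_comp, Category.assoc,
      conjugateEquiv_counit, NatTrans.naturality_assoc]
  rw [h2, h]
  exact congrArg yonEquiv (eqToHom_aux₅ _ _ _ _)

/-- The mate of a 2-cell between left adjoints. -/
def mate (a : TypeAdjunction L G) (a' : TypeAdjunction L' G') (α : L ⟶ L') : G' ⟶ G where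
  nat := conjugateEquiv a'.adj a.adj α.nat
  proj := mate_proj a a' α

lemma mate_id (a : TypeAdjunction L G) : mate a a (𝟙 L) = 𝟙 G :=
  SliceHom.hom_ext (conjugateEquiv_id a.adj)

lemma mate_comp (a : TypeAdjunction L G) (a' : TypeAdjunction L' G') (a'' : TypeAdjunction L'' G'')
    (α : L ⟶ L') (β : L' ⟶ L'') : mate a a'' (α ≫ β) = mate a' a'' β ≫ mate a a' α :=
  SliceHom.hom_ext (conjugateEquiv_comp _ _ _ _ _).symm

/-- The mate of an invertible 2-cell between left adjoints. -/
def mateIso (a : TypeAdjunction L G) (a' : TypeAdjunction L' G') (α : L ≅ L') : G' ≅ G where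
  hom := mate a a' α.hom
  inv := mate a' a α.inv
  hom_inv_id := by rw [← mate_comp, α.inv_hom_id, mate_id]
  inv_hom_id := by rw [← mate_comp, α.hom_inv_id, mate_id]

/-- The identity adjunction. -/
def id (S : Schema T) : TypeAdjunction (CosliceHom.id (typeYon S)) (SliceHom.id (restr S)) where
  adj := Adjunction.id
  compat τ J f := congrArg yonEquiv (Eq.symm ((Category.id_comp _).trans
    ((Adjunction.homEquiv_counit _ _ _ _).trans (Category.comp_id _))))

/-- The composite of adjunctions. -/
def comp (a : TypeAdjunction L G) {K : CosliceHom (typeYon S) (typeYon S')}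
    {H : SliceHom (restr S') (restr S)} (b : TypeAdjunction K H) :
    TypeAdjunction (L.comp K) (H.comp G) where
  adj := a.adj.comp b.adj
  compat τ J f := by
    have h1 := a.compat τ (H.functor.obj J) f
    have h2 := b.compat τ J (eqToHom (L.obj_eq (op τ)).symm ≫ (a.adj.homEquiv _ _).symm f)
    have h3 : eqToHom ((H.comp G).obj_eq J) =
        eqToHom (G.obj_eq (H.functor.obj J)) ≫ eqToHom (H.obj_eq J) := (eqToHom_trans _ _).symm
    rw [h3]
    refine (congrArg (fun y => (eqToHom (H.obj_eq J)).hom.app τ y) h1).trans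
      (h2.trans (congrArg yonEquiv ?_))
    rw [Adjunction.comp_homEquiv, Equiv.symm_trans_apply, Adjunction.homEquiv_naturality_left_symm,
      eqToHom_map]
    exact eqToHom_trans_assoc _ _ _

end TypeAdjunction

section

variable [HasFiniteProducts T] {R S : Schema T}

/-- The adjunction `Λ_M ⊣ Γ_M`, as an adjunction compatible with types. -/
noncomputable def lambdaGamma (M : Bimodule R S) : TypeAdjunction (lambda M) (gamma M) where
  adj := lambdaAdj M
  compat τ J f := by
    obtain ⟨g, rfl⟩ := (lambdaHomEquiv M _ _).surjective f
    have h0 : ((lambdaAdj M).homEquiv _ _).symm (lambdaHomEquiv M _ _ g) = g := by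
      rw [lambdaAdj, Adjunction.mkOfHomEquiv_homEquiv, Equiv.symm_apply_apply]
    rw [h0, alg_eqToHom_app]
    change yonEquiv (eqToHom (M.obj_eq (op τ)).symm ≫ (lambdaUnit M).hom.app (op (.ty τ)) ≫
      (lambda M).functor.map (yonEquiv.symm (yonEquiv (𝟙 _))) ≫ g) = _
    rw [Equiv.symm_apply_apply, CategoryTheory.Functor.map_id]
    refine (congrArg (fun y => yonEquiv (_ ≫ _ ≫ y)) (Category.id_comp g)).trans ?_
    refine (congrArg (fun y => yonEquiv (_ ≫ y ≫ _)) (lambdaUnit_type M (op τ))).trans ?_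
    exact congrArg yonEquiv (eqToHom_aux₅ _ _ _ _)

end

/-- A 2-cell of `RAdjType T`, as a 2-cell of the bidual. -/
def coopHom {R S : Schema T} {G G' : (isRightAdj S R).FullSubcategory} (α : G'.obj ⟶ G.obj) :
    op G ⟶ op G' :=
  Quiver.Hom.op (V := (isRightAdj S R).FullSubcategory) (ObjectProperty.homMk α)

/-- An invertible 2-cell of `RAdjType T`, as an invertible 2-cell of the bidual. -/
def coopIso {R S : Schema T} {G G' : (isRightAdj S R).FullSubcategory} (α : G'.obj ≅ G.obj) :
    op G ≅ op G' :=
  ((isRightAdj S R).isoMk α).op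

/-- The data of the pseudofunctor `Λ`: a schema `S` is sent to `Inst S` under `Tᵒᵖ`, a bimodule `M`
to the left Kan extension `Λ_M`. -/
noncomputable def lambdaData (T : Type u) [SmallCategory T] [HasFiniteProducts T] :
    PseudofunctorData (HorData T) (LAdjType T) where
  obj S := ⟨S.schema⟩
  map {R S} M := ⟨lambda (R := R.schema) (S := S.schema) M,
    inferInstanceAs (lambda (R := R.schema) (S := S.schema) M).functor.IsLeftAdjoint⟩
  map₂ {R S _ _} φ := ObjectProperty.homMk (P := isLeftAdj R.schema S.schema) (lambdaMap φ)
  map₂_id M := ObjectProperty.hom_ext _ (lambdaMap_id M)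
  map₂_comp φ ψ := ObjectProperty.hom_ext _ (lambdaMap_comp φ ψ)
  mapId S := ObjectProperty.isoMk (isLeftAdj S.schema S.schema) (lambdaId S.schema)
  mapComp {R S S'} M N := ObjectProperty.isoMk (isLeftAdj R.schema S'.schema)
    (lambdaComp (R := R.schema) (S := S.schema) (S' := S'.schema) M N)

/-- The data of the pseudofunctor `Γ`: a schema `S` is sent to `Inst S` over `Alg T`, a bimodule
`M : R ⇸ S` to the functor `Γ_M : Inst S ⥤ Inst R`, and the constraints are the mates of those
of `Λ`. -/
noncomputable def gammaData (T : Type u) [SmallCategory T] [HasFiniteProducts T] :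
    PseudofunctorData (HorData T) (Coop (RAdjType T)) where
  obj S := ⟨⟨S.schema⟩⟩
  map {R S} M := op (⟨gamma (R := R.schema) (S := S.schema) M,
    inferInstanceAs (gamma (R := R.schema) (S := S.schema) M).functor.IsRightAdjoint⟩ :
      (isRightAdj S.schema R.schema).FullSubcategory)
  map₂ {R S _ _} φ := coopHom (R := R.schema) (S := S.schema) (gammaMap φ)
  map₂_id {R S} M := congrArg (coopHom (R := R.schema) (S := S.schema)) (gammaMap_id M)
  map₂_comp {R S _ _ _} φ ψ :=
    congrArg (coopHom (R := R.schema) (S := S.schema)) (gammaMap_comp φ ψ)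
  mapId S := coopIso ((lambdaGamma (unitBimodule S.schema)).mateIso (TypeAdjunction.id S.schema)
    (lambdaId S.schema))
  mapComp {R S S'} M N := coopIso
    ((lambdaGamma (R := R.schema) (S := S'.schema) (M ≫ N)).mateIso
      ((lambdaGamma (R := R.schema) (S := S.schema) M).comp
        (lambdaGamma (R := S.schema) (S := S'.schema) N))
      (lambdaComp (R := R.schema) (S := S.schema) (S' := S'.schema) M N))

/-- A choice, for each type-preserving left adjoint, of a right adjoint over `Alg T` with an
adjunction compatible with types. -/
structure RightAdjointChoice (T : Type u) [SmallCategory T] where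
  right {R S : Schema T} (L : CosliceHom (typeYon R) (typeYon S)) (hL : L.functor.IsLeftAdjoint) :
    SliceHom (restr S) (restr R)
  adj {R S : Schema T} (L : CosliceHom (typeYon R) (typeYon S)) (hL : L.functor.IsLeftAdjoint) :
    TypeAdjunction L (right L hL)

/-- The data of the pseudofunctor sending each type-preserving left adjoint to its right adjoint,
and each 2-cell to its mate. -/
def RightAdjointChoice.data (c : RightAdjointChoice T) :
    PseudofunctorData (LAdjType T) (Coop (RAdjType T)) where
  obj S := ⟨⟨S.schema⟩⟩
  map {R S} L := op (⟨c.right (R := R.schema) (S := S.schema) L.obj L.property,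
    (c.adj (R := R.schema) (S := S.schema) L.obj L.property).adj.isRightAdjoint⟩ :
      (isRightAdj S.schema R.schema).FullSubcategory)
  map₂ {R S L L'} α := coopHom (R := R.schema) (S := S.schema)
    ((c.adj (R := R.schema) (S := S.schema) L.obj L.property).mate
      (c.adj (R := R.schema) (S := S.schema) L'.obj L'.property) α.hom)
  map₂_id {R S} L := congrArg (coopHom (R := R.schema) (S := S.schema))
    (TypeAdjunction.mate_id _)
  map₂_comp {R S _ _ _} α β := congrArg (coopHom (R := R.schema) (S := S.schema))
    (TypeAdjunction.mate_comp _ _ _ _ _)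
  mapId S := coopIso (R := S.schema) (S := S.schema)
    ((c.adj (R := S.schema) (S := S.schema) (𝟙 S : S ⟶ S).obj (𝟙 S : S ⟶ S).property).mateIso
      (TypeAdjunction.id S.schema) (Iso.refl _))
  mapComp {R S S'} L K := coopIso (R := R.schema) (S := S'.schema)
    ((c.adj (R := R.schema) (S := S'.schema) (L ≫ K).obj (L ≫ K).property).mateIso
      ((c.adj (R := R.schema) (S := S.schema) L.obj L.property).comp
        (c.adj (R := S.schema) (S := S'.schema) K.obj K.property)) (Iso.refl _))

end AlgDB

/-! A left adjoint out of `Inst R` is determined by its values on representables. The Yoneda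
embedding `yon R` is dense, so the identity is the left Kan extension of `yon R` along itself. A
left adjoint preserves this extension, hence is `Λ` of its own restriction along `yon R`
(`lambdaRestrictYonIso`). As `yon R` is also fully faithful, the unit `M ⟶ Λ_M y_R` is invertible,
and 2-cells `Λ_M ⟶ Λ_N` amount to morphisms of bimodules `M ⟶ N` (`lambdaMap_bijective`). So `Λ` is
a local equivalence; its coherence laws hold because 2-cells out of a Kan extension agree as soon as
they agree after composition with the unit.

The side of right adjoints is obtained by taking mates. Let `F` be a pseudofunctor into
type-preserving left adjoints, with a right adjoint compatible with types for each of its values.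
The mates of the 2-cells and constraints of `F` form a pseudofunctor into the bidual
(`RightAdjoints.pseudofunctor`), each law being the mate of the same law for `F`. The case of the
identity is `Ψ`. The case of `Λ` is `Γ`, once precomposition with `φ` is recognised as the mate of
`lambdaMap φ` (`gammaMap_eq_mate`).

This construction preserves local equivalences (`RightAdjoints.isLocalEquivalence`), for two
reasons. Compatibility with types ensures that a transformation of left adjoints is the identity on
types exactly when its mate is the identity over algebras (`TypeAdjunction.mate_bijective`). And if
`G` is a right adjoint over algebras, with left adjoint `L`, then `Hom(L y τ, J) ≅ (G J) τ = J τ`;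
so `L` carries representables of types to representables of types up to isomorphism, and an
isomorphic functor does so strictly (`exists_leftTypeAdjunction`).

Finally, `Ψ ∘ Λ` and `Γ` both come from choices of right adjoints for the values of `Λ`. Two such
choices are compared by the mate of the identity transformation of `Λ`, taken with one choice at its
source and the other at its target (`RightAdjoints.compTrans`). -/

namespace AlgDB

variable {T : Type u} [SmallCategory T]

/-! ### Mates of whiskerings, associators and unitors. -/

namespace TypeAdjunction

variable {R S S' S'' : Schema T} {L L' L'' : CosliceHom (typeYon R) (typeYon S)}
  {G G' G'' : SliceHom (restr S) (restr R)}

/-- A 2-cell is determined by its underlying natural transformation, so this and the next four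
lemmas are the calculus of conjugate transformations. Passing to right adjoints reverses
composition, which exchanges the two whiskerings and the two unitors. -/
lemma mate_whiskerLeft (a : TypeAdjunction L G) {K K' : CosliceHom (typeYon S) (typeYon S')}
    {H H' : SliceHom (restr S') (restr S)} (b : TypeAdjunction K H) (b' : TypeAdjunction K' H')
    (β : K ⟶ K') :
    mate (a.comp b) (a.comp b') (CosliceHom.whiskerLeft L β) =
      SliceHom.whiskerRight (mate b b' β) G :=
  SliceHom.hom_ext (conjugateEquiv_whiskerLeft _ _ _ _)

lemma mate_whiskerRight (a : TypeAdjunction L G) (a' : TypeAdjunction L' G') (α : L ⟶ L')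
    {K : CosliceHom (typeYon S) (typeYon S')} {H : SliceHom (restr S') (restr S)}
    (b : TypeAdjunction K H) :
    mate (a.comp b) (a'.comp b) (CosliceHom.whiskerRight α K) =
      SliceHom.whiskerLeft H (mate a a' α) :=
  SliceHom.hom_ext (conjugateEquiv_whiskerRight _ _ _ _)

lemma mate_assoc (a : TypeAdjunction L G) {K : CosliceHom (typeYon S) (typeYon S')}
    {H : SliceHom (restr S') (restr S)} (b : TypeAdjunction K H)
    {P : CosliceHom (typeYon S') (typeYon S'')} {Q : SliceHom (restr S'') (restr S')}
    (c : TypeAdjunction P Q) :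
    mate ((a.comp b).comp c) (a.comp (b.comp c)) (CosliceHom.assoc L K P).hom =
      (SliceHom.assoc Q H G).hom :=
  SliceHom.hom_ext (conjugateEquiv_associator_hom _ _ _)

lemma mate_leftUnitor (a : TypeAdjunction L G) :
    mate ((TypeAdjunction.id R).comp a) a (CosliceHom.leftUnitor L).hom =
      (SliceHom.rightUnitor G).inv :=
  SliceHom.hom_ext (conjugateEquiv_leftUnitor_hom _)

lemma mate_rightUnitor (a : TypeAdjunction L G) :
    mate (a.comp (TypeAdjunction.id S)) a (CosliceHom.rightUnitor L).hom =
      (SliceHom.leftUnitor G).inv :=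
  SliceHom.hom_ext (conjugateEquiv_rightUnitor_hom _)

end TypeAdjunction

end AlgDB

/-! ### The pseudofunctor of left Kan extensions. -/

namespace AlgDB

variable {T : Type u} [SmallCategory T] [HasFiniteProducts T]

/-- Both sides start at a left Kan extension, so it is enough to compare them on the unit. There the
equation is the naturality of `Λ_y ≅ id` at the components of the unit of `M`. -/
lemma lambdaComp_rightUnitor {R S : Schema T} (M : Bimodule R S) :
    lambdaMap (bimoduleRightUnitor M).hom = (lambdaComp M (unitBimodule S)).hom ≫
      CosliceHom.whiskerLeft (lambda M) (lambdaId S).hom ≫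
      (CosliceHom.rightUnitor (lambda M)).hom := by
  ext1
  refine lambda_hom_ext fun r => ?_
  simp only [CosliceHom.comp_nat_app, lambdaMap_fac, CosliceHom.whiskerLeft_nat_app]
  refine Eq.trans ?_ (lambdaComp_fac_assoc M (unitBimodule S) r _).symm
  rw [bimoduleRightUnitor_hom_app]
  refine ((lambdaId S).hom.nat.naturality ((lambdaUnit M).hom.app r)).symm.trans ?_
  exact congrArg (fun x => _ ≫ x) (Category.comp_id _).symm

/-- The pseudofunctor `Λ`. -/
noncomputable def lambdaPseudofunctor (T : Type u) [SmallCategory T] [HasFiniteProducts T] :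
    Pseudofunctor (HorData T) (LAdjType T) where
  toPrelaxFunctor := (lambdaData T).toPrelaxFunctor
  mapId := (lambdaData T).mapId
  mapComp := (lambdaData T).mapComp
  map₂_whisker_left M N N' φ := ObjectProperty.hom_ext _ (by
    refine Eq.trans ?_ (Category.assoc _ _ _)
    exact (Iso.eq_comp_inv _).2 (lambdaComp_whiskerLeft M φ))
  map₂_whisker_right θ N := ObjectProperty.hom_ext _ (by
    refine Eq.trans ?_ (Category.assoc _ _ _)
    exact (Iso.eq_comp_inv _).2 (lambdaComp_whiskerRight θ N))
  map₂_associator {R S S' S''} M N P := ObjectProperty.hom_ext _ (by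
    have h := lambdaComp_assoc (R := R.schema) (S := S.schema) (S' := S'.schema)
      (S'' := S''.schema) M N P
    -- The law wanted has the image of the associator alone on one side, so the two constraints that
    -- follow it in `lambdaComp_assoc` are moved across as inverses.
    have h' : lambdaMap (bimoduleAssoc M N P).hom =
        ((lambdaComp (M.comp (lambda N)) P).hom ≫
          CosliceHom.whiskerRight (lambdaComp M N).hom (lambda P) ≫
          (CosliceHom.assoc (lambda M) (lambda N) (lambda P)).hom) ≫
        (CosliceHom.whiskerLeftIso (lambda M) (lambdaComp N P)).inv ≫
        (lambdaComp M (N.comp (lambda P))).inv := by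
      rw [← h]
      simp only [Category.assoc]
      rw [← CosliceHom.whiskerLeftIso_hom, Iso.hom_inv_id_assoc, Iso.hom_inv_id, Category.comp_id]
    refine h'.trans ?_
    simp only [Category.assoc]
    rfl)
  map₂_left_unitor M := ObjectProperty.hom_ext _ (lambdaComp_leftUnitor M)
  map₂_right_unitor M := ObjectProperty.hom_ext _ (lambdaComp_rightUnitor M)

end AlgDB

/-! ### The pseudofunctor of right adjoints obtained by taking mates. -/

namespace AlgDB

variable {T : Type u} [SmallCategory T]

/-- A choice of right adjoints over `Alg T` for the values of a pseudofunctor with values in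
type-preserving left adjoints, together with a description of the mates of its 2-cells. -/
structure RightAdjoints {B : Type*} [Bicategory B] (F : Pseudofunctor B (LAdjType T)) where
  right {a b : B} (f : a ⟶ b) : SliceHom (restr (F.obj b).schema) (restr (F.obj a).schema)
  adj {a b : B} (f : a ⟶ b) : TypeAdjunction (F.map f).obj (right f)
  -- Although `map₂_eq` determines this field, keeping it as data lets the action of `Γ` on 2-cells
  -- be precomposition by definition.
  map₂ {a b : B} {f g : a ⟶ b} (η : f ⟶ g) : right g ⟶ right f
  map₂_eq {a b : B} {f g : a ⟶ b} (η : f ⟶ g) :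
    map₂ η = (adj f).mate (adj g) (F.map₂ η).hom

namespace RightAdjoints

variable {B : Type*} [Bicategory B] {F : Pseudofunctor B (LAdjType T)} (r : RightAdjoints F)

lemma map₂_id {a b : B} (f : a ⟶ b) : r.map₂ (𝟙 f) = 𝟙 _ := by
  rw [r.map₂_eq, F.map₂_id]
  exact TypeAdjunction.mate_id _

lemma map₂_comp {a b : B} {f g h : a ⟶ b} (η : f ⟶ g) (θ : g ⟶ h) :
    r.map₂ (η ≫ θ) = r.map₂ θ ≫ r.map₂ η := by
  rw [r.map₂_eq, r.map₂_eq, r.map₂_eq, F.map₂_comp]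
  exact TypeAdjunction.mate_comp _ _ _ _ _

/-- The unit constraint, as an isomorphism of 1-cells under `Tᵒᵖ`. -/
def idIso (F : Pseudofunctor B (LAdjType T)) (a : B) :
    (F.map (𝟙 a)).obj ≅ CosliceHom.id (typeYon (F.obj a).schema) :=
  (isLeftAdj _ _).ι.mapIso (F.mapId a)

/-- The composition constraint, as an isomorphism of 1-cells under `Tᵒᵖ`. -/
def compIso (F : Pseudofunctor B (LAdjType T)) {a b c : B} (f : a ⟶ b) (g : b ⟶ c) :
    (F.map (f ≫ g)).obj ≅ (F.map f).obj.comp (F.map g).obj :=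
  (isLeftAdj _ _).ι.mapIso (F.mapComp f g)

/-- The pseudofunctor of right adjoints, whose constraints are mates. -/
def pseudofunctor : Pseudofunctor B (Coop (RAdjType T)) where
  obj a := ⟨⟨(F.obj a).schema⟩⟩
  map {a b} f := op (⟨r.right f, (r.adj f).adj.isRightAdjoint⟩ :
    (isRightAdj (F.obj b).schema (F.obj a).schema).FullSubcategory)
  map₂ η := coopHom (r.map₂ η)
  map₂_id f := congrArg coopHom (r.map₂_id f)
  map₂_comp η θ := congrArg coopHom (r.map₂_comp η θ)
  mapId a := coopIso ((r.adj (𝟙 a)).mateIso (TypeAdjunction.id _) (idIso F a))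
  mapComp f g := coopIso ((r.adj (f ≫ g)).mateIso ((r.adj f).comp (r.adj g)) (compIso F f g))
  map₂_whisker_left {a b c} f g h η := by
    refine congrArg (coopHom (R := (F.obj a).schema) (S := (F.obj c).schema)) ?_
    -- The pattern of all five laws: take the mate of the law for `F`, cut it with `mate_comp` into
    -- the mates of its factors, in reverse order, and identify these one at a time. The adjunction
    -- given to `mate_comp` is the one at the intermediate 1-cell.
    refine (r.map₂_eq _).trans ((congrArg
      (fun x => TypeAdjunction.mate _ _ (InducedCategory.Hom.hom x))
      (F.map₂_whisker_left f η)).trans ?_)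
    refine (TypeAdjunction.mate_comp _ ((r.adj f).comp (r.adj g)) _ _ _).trans ?_
    refine (congrArg (fun x => x ≫ _)
      (TypeAdjunction.mate_comp _ ((r.adj f).comp (r.adj h)) _ _ _)).trans ?_
    refine (congrArg (fun x => (_ ≫ x) ≫ _)
      (TypeAdjunction.mate_whiskerLeft (r.adj f) (r.adj g) (r.adj h) (F.map₂ η).hom)).trans ?_
    rw [← r.map₂_eq]
    rfl
  map₂_whisker_right {a b c f g} η h := by
    refine congrArg (coopHom (R := (F.obj a).schema) (S := (F.obj c).schema)) ?_
    refine (r.map₂_eq _).trans ((congrArg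
      (fun x => TypeAdjunction.mate _ _ (InducedCategory.Hom.hom x))
      (F.map₂_whisker_right η h)).trans ?_)
    refine (TypeAdjunction.mate_comp _ ((r.adj f).comp (r.adj h)) _ _ _).trans ?_
    refine (congrArg (fun x => x ≫ _)
      (TypeAdjunction.mate_comp _ ((r.adj g).comp (r.adj h)) _ _ _)).trans ?_
    refine (congrArg (fun x => (_ ≫ x) ≫ _)
      (TypeAdjunction.mate_whiskerRight (r.adj f) (r.adj g) (F.map₂ η).hom (r.adj h))).trans ?_
    rw [← r.map₂_eq]
    rfl
  map₂_associator {a b c d} f g h := by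
    refine congrArg (coopHom (R := (F.obj a).schema) (S := (F.obj d).schema)) ?_
    refine (r.map₂_eq _).trans ((congrArg
      (fun x => TypeAdjunction.mate _ _ (InducedCategory.Hom.hom x))
      (F.map₂_associator f g h)).trans ?_)
    -- Five factors need four cuts, at `F(fg)·Fh`, `(Ff·Fg)·Fh`, `Ff·(Fg·Fh)` and `Ff·F(gh)`. The
    -- first and last factors are constraints, whose mates are already in the required form.
    refine (TypeAdjunction.mate_comp _ ((r.adj (f ≫ g)).comp (r.adj h)) _ _ _).trans ?_
    refine (congrArg (fun x => x ≫ _)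
      (TypeAdjunction.mate_comp _ (((r.adj f).comp (r.adj g)).comp (r.adj h)) _ _ _)).trans ?_
    refine (congrArg (fun x => (x ≫ _) ≫ _)
      (TypeAdjunction.mate_comp _ ((r.adj f).comp ((r.adj g).comp (r.adj h))) _ _ _)).trans ?_
    refine (congrArg (fun x => ((x ≫ _) ≫ _) ≫ _)
      (TypeAdjunction.mate_comp _ ((r.adj f).comp (r.adj (g ≫ h))) _ _ _)).trans ?_
    refine (congrArg (fun x => (((_ ≫ x) ≫ _) ≫ _) ≫ _)
      (TypeAdjunction.mate_whiskerLeft (r.adj f) _ _ (compIso F g h).inv)).trans ?_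
    refine (congrArg (fun x => ((_ ≫ x) ≫ _) ≫ _)
      (TypeAdjunction.mate_assoc (r.adj f) (r.adj g) (r.adj h))).trans ?_
    exact congrArg (fun x => (_ ≫ x) ≫ _)
      (TypeAdjunction.mate_whiskerRight _ _ (compIso F f g).hom (r.adj h))
  map₂_left_unitor {a b} f := by
    refine congrArg (coopHom (R := (F.obj a).schema) (S := (F.obj b).schema)) ?_
    refine (r.map₂_eq _).trans ((congrArg
      (fun x => TypeAdjunction.mate _ _ (InducedCategory.Hom.hom x))
      (F.map₂_left_unitor f)).trans ?_)
    refine (TypeAdjunction.mate_comp _ ((r.adj (𝟙 a)).comp (r.adj f)) _ _ _).trans ?_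
    refine (congrArg (fun x => x ≫ _)
      (TypeAdjunction.mate_comp _ ((TypeAdjunction.id _).comp (r.adj f)) _ _ _)).trans ?_
    -- The left unitor of the bidual is the inverse of the right unitor of the original bicategory,
    -- which is what the mate of the left unitor gives.
    refine (congrArg (fun x => (x ≫ _) ≫ _)
      (TypeAdjunction.mate_leftUnitor (r.adj f))).trans ?_
    exact congrArg (fun x => (_ ≫ x) ≫ _)
      (TypeAdjunction.mate_whiskerRight _ _ (idIso F a).hom (r.adj f))
  map₂_right_unitor {a b} f := by
    refine congrArg (coopHom (R := (F.obj a).schema) (S := (F.obj b).schema)) ?_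
    refine (r.map₂_eq _).trans ((congrArg
      (fun x => TypeAdjunction.mate _ _ (InducedCategory.Hom.hom x))
      (F.map₂_right_unitor f)).trans ?_)
    refine (TypeAdjunction.mate_comp _ ((r.adj f).comp (r.adj (𝟙 b))) _ _ _).trans ?_
    refine (congrArg (fun x => x ≫ _)
      (TypeAdjunction.mate_comp _ ((r.adj f).comp (TypeAdjunction.id _)) _ _ _)).trans ?_
    refine (congrArg (fun x => (x ≫ _) ≫ _)
      (TypeAdjunction.mate_rightUnitor (r.adj f))).trans ?_
    exact congrArg (fun x => (_ ≫ x) ≫ _)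
      (TypeAdjunction.mate_whiskerLeft (r.adj f) _ _ (idIso F b).hom)

end RightAdjoints

end AlgDB

/-! ### Comparison of two choices of right adjoints. -/

namespace AlgDB

variable {T : Type u} [SmallCategory T]

namespace TypeAdjunction

variable {R S : Schema T} {L L' : CosliceHom (typeYon R) (typeYon S)}
  {G G' : SliceHom (restr S) (restr R)}

/-- Inverses are unique, and the mates of `e.hom` and `e.inv` are inverse to each other. This gives
the mates of the inverse associators and unitors that occur in the axioms of a transformation. -/
lemma mate_inv_eq (a : TypeAdjunction L G) (a' : TypeAdjunction L' G') (e : L ≅ L') (i : G ≅ G')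
    (h : mate a a' e.hom = i.inv) : mate a' a e.inv = i.hom :=
  congrArg Iso.inv (Iso.ext (α := mateIso a a' e) (β := i.symm) h)

end TypeAdjunction

namespace RightAdjoints

variable {B : Type*} [Bicategory B] {F : Pseudofunctor B (LAdjType T)}
  (s : RightAdjoints (Pseudofunctor.id (LAdjType T))) (r : RightAdjoints F)

/-- The adjunction chosen by `s` for a value of `F`. -/
def adjMap (F : Pseudofunctor B (LAdjType T)) {a b : B} (f : a ⟶ b) :
    TypeAdjunction (F.map f).obj (s.right (F.map f)) :=
  s.adj (F.map f)

lemma adjMap_mate {a b : B} {f g : a ⟶ b} (η : f ⟶ g) :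
    s.map₂ (F.map₂ η) = (s.adjMap F f).mate (s.adjMap F g) (F.map₂ η).hom :=
  s.map₂_eq _

/-- The constraint of a composite pseudofunctor is built from the image of the inner constraint and
the outer constraint. Here both are mates, and the outer one is the mate of an identity because `s`
lies over the identity pseudofunctor; so together they form the mate of the constraint of `F`. The
same argument gives `comp_mapComp_hom`. -/
lemma comp_mapId_hom (a : B) :
    ((F.comp s.pseudofunctor).mapId a).hom = coopHom
      ((s.adjMap F (𝟙 a)).mate (TypeAdjunction.id (F.obj a).schema) (F.mapId a).hom.hom) := by
  rw [Pseudofunctor.comp_mapId]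
  refine congrArg coopHom ?_
  refine (congrArg (fun x => _ ≫ x) (s.map₂_eq _)).trans ?_
  refine (TypeAdjunction.mate_comp _ _ _ _ _).symm.trans ?_
  exact congrArg (TypeAdjunction.mate _ _) (Category.comp_id _)

lemma comp_mapComp_hom {a b c : B} (f : a ⟶ b) (g : b ⟶ c) :
    ((F.comp s.pseudofunctor).mapComp f g).hom = coopHom
      ((s.adjMap F (f ≫ g)).mate ((s.adjMap F f).comp (s.adjMap F g))
        (F.mapComp f g).hom.hom) := by
  rw [Pseudofunctor.comp_mapComp]
  refine congrArg coopHom ?_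
  refine (congrArg (fun x => _ ≫ x) (s.map₂_eq _)).trans ?_
  refine (TypeAdjunction.mate_comp _ _ _ _ _).symm.trans ?_
  exact congrArg (TypeAdjunction.mate _ _) (Category.comp_id _)

/-- The isomorphism `L ⋙ 𝟭 ≅ 𝟭 ⋙ L` for the value `L` of `F` at `f`. -/
def unitorIso (F : Pseudofunctor B (LAdjType T)) {a b : B} (f : a ⟶ b) :
    (F.map f).obj.comp (CosliceHom.id _) ≅ (CosliceHom.id _).comp (F.map f).obj :=
  CosliceHom.rightUnitor _ ≪≫ (CosliceHom.leftUnitor _).symm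

set_option maxHeartbeats 1600000 in
/-- Two choices of right adjoints for the same pseudofunctor agree up to an invertible
pseudonatural transformation whose components are identities. -/
def compTrans : Pseudofunctor.StrongTrans (F.comp s.pseudofunctor) r.pseudofunctor where
  app a := 𝟙 (⟨⟨(F.obj a).schema⟩⟩ : Coop (RAdjType T))
  -- This is the mate of the naturality cell of `Pseudofunctor.StrongTrans.id F`, with the
  -- adjunction of `s` at its source and that of `r` at its target. Each axiom below is then the
  -- mate of the same axiom for the identity transformation.
  naturality {a b} f := coopIso (R := (F.obj a).schema) (S := (F.obj b).schema)
    (((s.adjMap F f).comp (TypeAdjunction.id _)).mateIso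
    ((TypeAdjunction.id _).comp (r.adj f)) (unitorIso F f))
  naturality_naturality {a b f g} η := by
    refine congrArg (coopHom (R := (F.obj a).schema) (S := (F.obj b).schema)) ?_
    have h := congrArg (fun x => TypeAdjunction.mate
      ((s.adjMap F f).comp (TypeAdjunction.id _)) ((TypeAdjunction.id _).comp (r.adj g))
      (InducedCategory.Hom.hom x)) ((Pseudofunctor.StrongTrans.id F).naturality_naturality η)
    refine Eq.trans ?_ (h.trans ?_)
    · refine Eq.symm ((TypeAdjunction.mate_comp _
        ((s.adjMap F g).comp (TypeAdjunction.id _)) _ _ _).trans ?_)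
      refine (congrArg (fun x => _ ≫ x) (TypeAdjunction.mate_whiskerRight _ _ _ _)).trans ?_
      rw [← s.adjMap_mate]
      rfl
    · refine (TypeAdjunction.mate_comp _
        ((TypeAdjunction.id _).comp (r.adj f)) _ _ _).trans ?_
      refine (congrArg (fun x => x ≫ _) (TypeAdjunction.mate_whiskerLeft _ _ _ _)).trans ?_
      rw [← r.map₂_eq]
      rfl
  naturality_id a := by
    rw [comp_mapId_hom]
    refine congrArg (coopHom (R := (F.obj a).schema) (S := (F.obj a).schema)) ?_
    have h := congrArg (fun x => TypeAdjunction.mate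
      ((s.adjMap F (𝟙 a)).comp (TypeAdjunction.id _))
      ((TypeAdjunction.id _).comp (TypeAdjunction.id _))
      (InducedCategory.Hom.hom x)) ((Pseudofunctor.StrongTrans.id F).naturality_id a)
    refine Eq.trans ?_ (h.trans ?_)
    · refine Eq.symm ((TypeAdjunction.mate_comp _
        ((TypeAdjunction.id _).comp (r.adj (𝟙 a))) _ _ _).trans ?_)
      exact congrArg (fun x => x ≫ _) (TypeAdjunction.mate_whiskerLeft _ _ _ (idIso F a).hom)
    · refine (TypeAdjunction.mate_comp _
        ((TypeAdjunction.id _).comp (TypeAdjunction.id _)) _ _ _).trans ?_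
      refine (congrArg (fun x => x ≫ _) (TypeAdjunction.mate_comp _
        (TypeAdjunction.id _) _ _ _)).trans ?_
      -- The axiom contains the left unitor and the inverse of the right unitor of an identity
      -- 1-cell; only the second needs `mate_inv_eq`.
      refine (congrArg (fun x => (x ≫ _) ≫ _) (TypeAdjunction.mate_inv_eq _ _
        (CosliceHom.rightUnitor _) (SliceHom.leftUnitor _)
        (TypeAdjunction.mate_rightUnitor (TypeAdjunction.id (F.obj a).schema)))).trans ?_
      refine (congrArg (fun x => (_ ≫ x) ≫ _)
        (TypeAdjunction.mate_leftUnitor (TypeAdjunction.id (F.obj a).schema))).trans ?_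
      exact congrArg (fun x => (_ ≫ _) ≫ x)
        (TypeAdjunction.mate_whiskerRight _ _ (idIso F a).hom _)
  naturality_comp {a b c} f g := by
    rw [comp_mapComp_hom]
    refine congrArg (coopHom (R := (F.obj a).schema) (S := (F.obj c).schema)) ?_
    have h := congrArg (fun x => TypeAdjunction.mate
      ((s.adjMap F (f ≫ g)).comp (TypeAdjunction.id _))
      ((TypeAdjunction.id _).comp ((r.adj f).comp (r.adj g)))
      (InducedCategory.Hom.hom x)) ((Pseudofunctor.StrongTrans.id F).naturality_comp f g)
    refine Eq.trans ?_ (h.trans ?_)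
    · refine Eq.symm ((TypeAdjunction.mate_comp _
        ((TypeAdjunction.id _).comp (r.adj (f ≫ g))) _ _ _).trans ?_)
      exact congrArg (fun x => x ≫ _) (TypeAdjunction.mate_whiskerLeft _ _ _ (compIso F f g).hom)
    · refine (TypeAdjunction.mate_comp _
        (((s.adjMap F f).comp (s.adjMap F g)).comp (TypeAdjunction.id _)) _ _ _).trans ?_
      refine (congrArg (fun x => x ≫ _) (TypeAdjunction.mate_comp _
        ((s.adjMap F f).comp ((s.adjMap F g).comp (TypeAdjunction.id _))) _ _ _)).trans ?_
      refine (congrArg (fun x => (x ≫ _) ≫ _) (TypeAdjunction.mate_comp _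
        ((s.adjMap F f).comp ((TypeAdjunction.id _).comp (r.adj g))) _ _ _)).trans ?_
      refine (congrArg (fun x => ((x ≫ _) ≫ _) ≫ _) (TypeAdjunction.mate_comp _
        (((s.adjMap F f).comp (TypeAdjunction.id _)).comp (r.adj g)) _ _ _)).trans ?_
      refine (congrArg (fun x => (((x ≫ _) ≫ _) ≫ _) ≫ _) (TypeAdjunction.mate_comp _
        (((TypeAdjunction.id _).comp (r.adj f)).comp (r.adj g)) _ _ _)).trans ?_
      refine (congrArg (fun x => ((((x ≫ _) ≫ _) ≫ _) ≫ _) ≫ _)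
        (TypeAdjunction.mate_assoc (TypeAdjunction.id _) (r.adj f) (r.adj g))).trans ?_
      refine (congrArg (fun x => ((((_ ≫ x) ≫ _) ≫ _) ≫ _) ≫ _)
        (TypeAdjunction.mate_whiskerRight _ _ (unitorIso F f).hom (r.adj g))).trans ?_
      refine (congrArg (fun x => (((_ ≫ x) ≫ _) ≫ _) ≫ _) (TypeAdjunction.mate_inv_eq _ _
        (CosliceHom.assoc _ _ _) (SliceHom.assoc _ _ _).symm (TypeAdjunction.mate_assoc
          (s.adjMap F f) (TypeAdjunction.id _) (r.adj g)))).trans ?_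
      refine (congrArg (fun x => ((_ ≫ x) ≫ _) ≫ _)
        (TypeAdjunction.mate_whiskerLeft (s.adjMap F f) _ _ (unitorIso F g).hom)).trans ?_
      refine (congrArg (fun x => (_ ≫ x) ≫ _) (TypeAdjunction.mate_assoc
        (s.adjMap F f) (s.adjMap F g) (TypeAdjunction.id _))).trans ?_
      exact congrArg (fun x => _ ≫ x)
        (TypeAdjunction.mate_whiskerRight _ _ (compIso F f g).hom _)

end RightAdjoints

end AlgDB

/-! ### Mates and the conditions on types. -/

namespace AlgDB

variable {T : Type u} [SmallCategory T]

namespace TypeAdjunction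

variable {R S : Schema T} {L L' : CosliceHom (typeYon R) (typeYon S)}
  {G G' : SliceHom (restr S) (restr R)}

/-- The converse of `mate_proj`. By the Yoneda lemma it is enough to compare elements at the type
`τ`. Compatibility of `a'` turns the identity of `L' (y τ)` into its transpose `f`, and
compatibility of `a` turns the component of the transformation into `f` followed by `β`. These give
the same element because `β` is the identity over algebras. -/
lemma restrict_conjugateEquiv_symm (a : TypeAdjunction L G) (a' : TypeAdjunction L' G')
    (β : G' ⟶ G) (τ : Tᵒᵖ) :
    ((conjugateEquiv a'.adj a.adj).symm β.nat).app ((typeYon R).obj τ) =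
      eqToHom ((L.obj_eq τ).trans (L'.obj_eq τ).symm) := by
  set α := (conjugateEquiv a'.adj a.adj).symm β.nat
  have hα : conjugateEquiv a'.adj a.adj α = β.nat := Equiv.apply_symm_apply _ _
  rw [← cancel_epi (eqToHom (L.obj_eq τ).symm), eqToHom_trans]
  apply yonEquiv.injective
  let J := L'.functor.obj ((typeYon R).obj τ)
  let f : (typeYon R).obj τ ⟶ G'.functor.obj J := a'.adj.homEquiv _ _ (𝟙 J)
  have h1 := a'.compat τ.unop J f
  have h2 := a.compat τ.unop J (f ≫ β.nat.app J)
  have h3 : (a.adj.homEquiv _ _).symm (f ≫ β.nat.app J) = α.app ((typeYon R).obj τ) := by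
    rw [← hα, Adjunction.homEquiv_counit, Functor.map_comp, Category.assoc,
      conjugateEquiv_counit, NatTrans.naturality_assoc, ← Adjunction.homEquiv_counit]
    refine (congrArg (fun x => _ ≫ x) (Equiv.symm_apply_apply _ _)).trans (Category.comp_id _)
  have h4 : (a'.adj.homEquiv _ _).symm f = 𝟙 J := Equiv.symm_apply_apply _ _
  rw [h4] at h1
  rw [h3] at h2
  refine h2.symm.trans (Eq.trans ?_ (h1.trans (congrArg yonEquiv (Category.comp_id _))))
  have h5 := (congrArg (fun x => x ≫ eqToHom (G.obj_eq J)) (β.proj J)).trans (eqToHom_trans _ _)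
  exact ConcreteCategory.congr_hom (NatTrans.congr_app (congrArg InducedCategory.Hom.hom h5) τ.unop)
    (yonEquiv f)

/-- The 2-cell between left adjoints with a given mate. -/
def unmate (a : TypeAdjunction L G) (a' : TypeAdjunction L' G') (β : G' ⟶ G) : L ⟶ L' where
  nat := (conjugateEquiv a'.adj a.adj).symm β.nat
  restrict := restrict_conjugateEquiv_symm a a' β

/-- Conjugation is already bijective on natural transformations; `mate_proj` and
`restrict_conjugateEquiv_symm` say that it respects the conditions on types in both directions. -/
lemma mate_bijective (a : TypeAdjunction L G) (a' : TypeAdjunction L' G') :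
    Function.Bijective (mate a a') :=
  ⟨fun _ _ h => CosliceHom.hom_ext ((conjugateEquiv a'.adj a.adj).injective
    (congrArg SliceHom.Hom.nat h)),
    fun β => ⟨unmate a a' β, SliceHom.hom_ext (Equiv.apply_symm_apply _ _)⟩⟩

/-- The transport of an adjunction along an isomorphism of left adjoints. -/
def ofIsoLeft (a : TypeAdjunction L G) (e : L ≅ L') : TypeAdjunction L' G where
  adj := a.adj.ofNatIsoLeft ⟨e.hom.nat, e.inv.nat, congrArg CosliceHom.Hom.nat e.hom_inv_id,
    congrArg CosliceHom.Hom.nat e.inv_hom_id⟩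
  compat τ J f := by
    refine (a.compat τ J f).trans (congrArg yonEquiv ?_)
    -- Transposition under the transported adjunction inserts a component of `e.inv`, which on types
    -- is an `eqToHom`.
    rw [Adjunction.homEquiv_ofNatIsoLeft_symm_apply]
    refine Eq.trans ?_ (congrArg (fun x => _ ≫ x ≫ _) (e.inv.restrict (op τ)).symm)
    exact (eqToHom_trans_assoc _ _ _).symm

end TypeAdjunction

/-! ### Left adjoints as Kan extensions of bimodules. -/

section

variable [HasFiniteProducts T] {R S : Schema T} (L : CosliceHom (typeYon R) (typeYon S))

/-- The bimodule obtained by restricting a 1-cell under `Tᵒᵖ` along the Yoneda embedding. -/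
def restrictYon (L : CosliceHom (typeYon R) (typeYon S)) : Bimodule R S where
  functor := yon R ⋙ L.functor
  w := L.w

/-- A left adjoint is the left Kan extension of its restriction along the Yoneda embedding. -/
noncomputable def lambdaRestrictYonIso (hL : L.functor.IsLeftAdjoint) :
    lambda (restrictYon L) ≅ L :=
  haveI : L.functor.IsLeftKanExtension (F := (restrictYon L).functor) (L := yon R)
      (𝟙 (yon R ⋙ L.functor)) := by
    have : PreservesColimitsOfSize.{u, u} L.functor :=
      (Adjunction.ofIsLeftAdjoint L.functor).leftAdjoint_preservesColimits
    -- Density of `yon R` exhibits the identity functor as the left Kan extension of `yon R` along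
    -- itself; `L` preserves it since it preserves colimits.
    have h := Functor.PreservesLeftKanExtension.preserves (G := L.functor) (F := yon R)
      (L := yon R) (𝟭 _) (yon R).rightUnitor.inv
    have e : Functor.whiskerRight (yon R).rightUnitor.inv L.functor = 𝟙 (yon R ⋙ L.functor) := by
      ext1
      ext1 r
      exact L.functor.map_id _
    rw [← e]
    exact h
  lambdaIso (restrictYon L) L (𝟙 (yon R ⋙ L.functor)) fun τ => rfl

/-- The right adjoint over `Alg T` of a type-preserving left adjoint. -/
noncomputable def rightTypeAdjunction (hL : L.functor.IsLeftAdjoint) :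
    TypeAdjunction L (gamma (restrictYon L)) :=
  (lambdaGamma (restrictYon L)).ofIsoLeft (lambdaRestrictYonIso L hL)

lemma nonempty_rightAdjointChoice : Nonempty (RightAdjointChoice T) :=
  ⟨{ right L _ := gamma (restrictYon L)
     adj L hL := rightTypeAdjunction L hL }⟩

/-- A morphism of bimodules `M ⟶ N` from a 2-cell `Λ_M ⟶ Λ_N`. -/
noncomputable def ofLambdaHom {M N : Bimodule R S} (α : lambda M ⟶ lambda N) : M ⟶ N :=
  (bimoduleLeftUnitor M).inv ≫ CosliceHom.whiskerLeft (unitBimodule R) α ≫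
    (bimoduleLeftUnitor N).hom

/-- The universal property identifies 2-cells out of `Λ_M` with their restrictions along the unit of
`M`, and the unit of `N` is invertible, so these restrictions are morphisms `M ⟶ N`. -/
lemma lambdaMap_bijective (M N : Bimodule R S) :
    Function.Bijective (lambdaMap : (M ⟶ N) → (lambda M ⟶ lambda N)) := by
  constructor
  · intro φ ψ h
    refine CosliceHom.hom_ext (NatTrans.ext (funext fun r => ?_))
    rw [← cancel_mono ((lambdaUnit N).hom.app r)]
    refine (lambdaMap_fac φ r).symm.trans (Eq.trans ?_ (lambdaMap_fac ψ r))
    rw [h]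
  · intro α
    refine ⟨ofLambdaHom α, CosliceHom.hom_ext (lambda_hom_ext fun r => ?_)⟩
    rw [lambdaMap_fac]
    have h := NatTrans.congr_app (congrArg CosliceHom.Hom.nat
      (bimoduleLeftUnitor N).hom_inv_id) r
    refine (Category.assoc _ _ _).trans (congrArg (fun x => _ ≫ x) ?_)
    refine (Category.assoc _ _ _).trans ?_
    exact (congrArg (fun x => _ ≫ x) h).trans (Category.comp_id _)

end

end AlgDB

/-! ### Strictly type-preserving left adjoints of functors over algebras. -/

namespace AlgDB

variable {T : Type u} [SmallCategory T]

section

variable {R S : Schema T} (G : SliceHom (restr S) (restr R))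

/-- The Yoneda bijection `(y τ ⟶ G J) ≃ J τ ≃ (y τ ⟶ J)` for a 1-cell `G` over `Alg T`. -/
def sliceYonEquiv (τ : T) (J : Inst S) :
    ((typeYon R).obj (op τ) ⟶ G.functor.obj J) ≃ ((typeYon S).obj (op τ) ⟶ J) :=
  (yonEquiv.trans (((isAlg T).ι ⋙ (evaluation T (Type u)).obj τ).mapIso
    (eqToIso (G.obj_eq J))).toEquiv).trans (yonEquiv (r := .ty τ)).symm

lemma yonEquiv_sliceYonEquiv (τ : T) (J : Inst S)
    (f : (typeYon R).obj (op τ) ⟶ G.functor.obj J) :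
    yonEquiv (sliceYonEquiv G τ J f) = (eqToHom (G.obj_eq J)).hom.app τ (yonEquiv f) :=
  yonEquiv.apply_symm_apply _

/-- Naturality in `J` comes from the equation `G ⋙ restr R = restr S` on morphisms. Naturality in
`τ`, in `sliceYonEquiv_map`, holds because each identification of the restriction of `G J` with that
of `J` is a morphism of algebras. -/
lemma sliceYonEquiv_comp (τ : T) {J J' : Inst S}
    (f : (typeYon R).obj (op τ) ⟶ G.functor.obj J) (g : J ⟶ J') :
    sliceYonEquiv G τ J' (f ≫ G.functor.map g) = sliceYonEquiv G τ J f ≫ g := by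
  apply yonEquiv.injective
  rw [yonEquiv_sliceYonEquiv]
  refine Eq.trans ?_ (congrArg (g.hom.app (.ty τ)) (yonEquiv_sliceYonEquiv G τ J f).symm)
  have h : (restr R).map (G.functor.map g) ≫ eqToHom (G.obj_eq J') =
      eqToHom (G.obj_eq J) ≫ (restr S).map g := by
    refine (congrArg (fun x => x ≫ _) (Functor.congr_hom G.w g)).trans ?_
    simp
  exact ConcreteCategory.congr_hom (NatTrans.congr_app (congrArg InducedCategory.Hom.hom h) τ)
    (yonEquiv f)

lemma sliceYonEquiv_map {τ σ : T} (t : τ ⟶ σ) (J : Inst S)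
    (f : (typeYon R).obj (op τ) ⟶ G.functor.obj J) :
    sliceYonEquiv G σ J ((typeYon R).map t.op ≫ f) =
      (typeYon S).map t.op ≫ sliceYonEquiv G τ J f := by
  apply yonEquiv.injective
  rw [yonEquiv_sliceYonEquiv]
  refine Eq.trans ?_ (yonEquiv_map (sliceYonEquiv G τ J f) ((incl S).map t)).symm
  rw [yonEquiv_sliceYonEquiv]
  refine (congrArg (fun x => (eqToHom (G.obj_eq J)).hom.app σ x)
    (yonEquiv_map f ((incl R).map t))).trans ?_
  exact (eqToHom (G.obj_eq J)).hom.naturality_apply t (yonEquiv f)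

variable {G} {L : Inst R ⥤ Inst S} (adj : L ⊣ G.functor)

/-- Morphisms out of `L (y τ)` and out of `y τ` agree if the right adjoint of `L` lies over
`Alg T`. -/
def leftTypeEquiv (τ : T) (J : Inst S) :
    (L.obj ((typeYon R).obj (op τ)) ⟶ J) ≃ ((typeYon S).obj (op τ) ⟶ J) :=
  (adj.homEquiv _ _).trans (sliceYonEquiv G τ J)

lemma leftTypeEquiv_comp (τ : T) {J J' : Inst S}
    (f : L.obj ((typeYon R).obj (op τ)) ⟶ J) (g : J ⟶ J') :
    leftTypeEquiv adj τ J' (f ≫ g) = leftTypeEquiv adj τ J f ≫ g := by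
  refine (congrArg (sliceYonEquiv G τ J') (adj.homEquiv_naturality_right f g)).trans ?_
  exact sliceYonEquiv_comp G τ _ g

lemma leftTypeEquiv_symm_comp (τ : T) {J J' : Inst S}
    (f : (typeYon S).obj (op τ) ⟶ J) (g : J ⟶ J') :
    (leftTypeEquiv adj τ J').symm (f ≫ g) = (leftTypeEquiv adj τ J).symm f ≫ g := by
  rw [Equiv.symm_apply_eq, leftTypeEquiv_comp, Equiv.apply_symm_apply]

lemma leftTypeEquiv_map {τ σ : T} (t : τ ⟶ σ) (J : Inst S)
    (f : L.obj ((typeYon R).obj (op τ)) ⟶ J) :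
    leftTypeEquiv adj σ J (L.map ((typeYon R).map t.op) ≫ f) =
      (typeYon S).map t.op ≫ leftTypeEquiv adj τ J f := by
  refine (congrArg (sliceYonEquiv G σ J) (adj.homEquiv_naturality_left _ f)).trans ?_
  exact sliceYonEquiv_map G t J _

/-- A left adjoint of a 1-cell over `Alg T` preserves types up to isomorphism. -/
def leftTypeIso : typeYon R ⋙ L ≅ typeYon S :=
  -- The instances `L (y τ)` and `y τ` corepresent the same functor of `J`, so mutually inverse
  -- comparison maps come from the two identities.
  (NatIso.ofComponents (fun τ =>
    { hom := leftTypeEquiv adj τ.unop _ (𝟙 _)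
      inv := (leftTypeEquiv adj τ.unop _).symm (𝟙 _)
      hom_inv_id := (leftTypeEquiv_comp adj τ.unop _ _).symm.trans
        ((congrArg _ (Category.id_comp _)).trans (Equiv.apply_symm_apply _ _))
      inv_hom_id := (leftTypeEquiv_symm_comp adj τ.unop _ _).symm.trans
        ((congrArg _ (Category.id_comp _)).trans (Equiv.symm_apply_apply _ _)) })
    (fun {τ σ} t => by
      refine (leftTypeEquiv_map adj t.unop _ (𝟙 _)).symm.trans (Eq.trans ?_
        (leftTypeEquiv_comp adj τ.unop (𝟙 _) (L.map ((typeYon R).map t))))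
      exact congrArg _ ((Category.comp_id _).trans (Category.id_comp _).symm)) :
    typeYon S ≅ typeYon R ⋙ L).symm

lemma leftTypeIso_inv_app_comp (τ : T) (J : Inst S)
    (f : L.obj ((typeYon R).obj (op τ)) ⟶ J) :
    (leftTypeIso adj).inv.app (op τ) ≫ f = leftTypeEquiv adj τ J f :=
  (leftTypeEquiv_comp adj τ (𝟙 _) f).symm.trans (congrArg _ (Category.id_comp f))

/-- The isomorphism used to replace a left adjoint by one which strictly preserves types. -/
def leftStrictIso : typeYon R ⋙ L ≅ typeYon R ⋙ (restr R ⋙ ext S) :=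
  -- To apply `strictify`, the target must factor through `typeYon R`. Restricting to types and
  -- extending by the empty set on entities is a functor on all of `Inst R` with the right values on
  -- types.
  leftTypeIso adj ≪≫ eqToIso (typeYon_eq R S).symm

/-- The replacement of a left adjoint by one which strictly preserves types. -/
noncomputable def strictLeft : CosliceHom (typeYon R) (typeYon S) where
  functor := strictify (leftStrictIso adj)
  w := (comp_strictify _).trans (typeYon_eq R S)

/-- The adjunction of a strictly type-preserving left adjoint with a right adjoint over `Alg T`. -/
noncomputable def leftTypeAdjunction : TypeAdjunction (strictLeft adj) G where
  adj := adj.ofNatIsoLeft (isoStrictify (leftStrictIso adj))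
  compat τ J f := by
    have h0 := adj.homEquiv_ofNatIsoLeft_symm_apply (isoStrictify (leftStrictIso adj)) f
    -- On types the strictifying isomorphism is `leftTypeIso` followed by an `eqToHom`. Precomposing
    -- with the inverse of `leftTypeIso` is `leftTypeEquiv`, in which the transposition of `adj`
    -- cancels, leaving the Yoneda identification `sliceYonEquiv`.
    have h : eqToHom ((strictLeft adj).obj_eq (op τ)).symm ≫
        (isoStrictify (leftStrictIso adj)).inv.app ((typeYon R).obj (op τ)) =
        (leftTypeIso adj).inv.app (op τ) := by
      have h1 := isoStrictify_hom_app (leftStrictIso adj) (op τ)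
      have h2 : (leftStrictIso adj).hom.app (op τ) = (leftTypeIso adj).hom.app (op τ) ≫
          eqToHom (Functor.congr_obj (typeYon_eq R S).symm (op τ)) :=
        congrArg (fun x => _ ≫ x) (eqToHom_app (typeYon_eq R S).symm _)
      have h3 : (leftTypeIso adj).hom.app (op τ) ≫
          eqToHom ((strictLeft adj).obj_eq (op τ)).symm =
          (isoStrictify (leftStrictIso adj)).hom.app ((typeYon R).obj (op τ)) := by
        rw [h1, h2]
        exact ((Category.assoc _ _ _).trans (congrArg (fun x => _ ≫ x) (eqToHom_trans _ _))).symm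
      refine (Iso.eq_inv_comp ((leftTypeIso adj).app (op τ))).2 ?_ |>.trans (Category.comp_id _)
      refine (Category.assoc _ _ _).symm.trans ?_
      refine (congrArg (fun x => x ≫ _) h3).trans ?_
      exact (isoStrictify (leftStrictIso adj)).hom_inv_id_app _
    refine Eq.trans ?_ (congrArg (fun x => yonEquiv (_ ≫ x)) h0.symm)
    refine Eq.trans ?_ (congrArg yonEquiv
      ((congrArg (fun x => x ≫ _) h.symm).trans (Category.assoc _ _ _)))
    rw [leftTypeIso_inv_app_comp]
    refine Eq.trans ?_ (congrArg (fun x => yonEquiv (sliceYonEquiv G τ J x))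
      ((adj.homEquiv _ _).apply_symm_apply f).symm)
    exact (yonEquiv_sliceYonEquiv G τ J f).symm

end

/-- Every right adjoint over `Alg T` has a strictly type-preserving left adjoint. -/
lemma exists_leftTypeAdjunction {R S : Schema T} (G : SliceHom (restr S) (restr R))
    (hG : G.functor.IsRightAdjoint) :
    ∃ L : CosliceHom (typeYon R) (typeYon S), Nonempty (TypeAdjunction L G) :=
  ⟨strictLeft (Adjunction.ofIsRightAdjoint G.functor), ⟨leftTypeAdjunction _⟩⟩

end AlgDB

/-! ### Local equivalences, and `Γ` as the mate of `Λ`. -/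

namespace AlgDB

variable {T : Type u} [SmallCategory T]

namespace RightAdjoints

variable {B : Type*} [Bicategory B] {F : Pseudofunctor B (LAdjType T)} (r : RightAdjoints F)

/-- If a pseudofunctor is a local equivalence, then so is the pseudofunctor of right adjoints. -/
lemma isLocalEquivalence (hF : IsLocalEquivalence F) : IsLocalEquivalence r.pseudofunctor := by
  intro a b
  have hFab := hF a b
  -- On 2-cells the action is a composite of bijections: that of `F`, the passage out of the full
  -- subcategory, and the formation of mates.
  have key : ∀ f g : a ⟶ b, Function.Bijective
      (fun η : f ⟶ g => (r.map₂ η : r.right g ⟶ r.right f)) := by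
    intro f g
    have h : (fun η : f ⟶ g => r.map₂ η) = (r.adj f).mate (r.adj g) ∘
        InducedCategory.Hom.hom ∘ (F.mapFunctor a b).map := funext fun η => r.map₂_eq η
    rw [h]
    refine (TypeAdjunction.mate_bijective _ _).comp (Function.Bijective.comp ?_
      ⟨(F.mapFunctor a b).map_injective, (F.mapFunctor a b).map_surjective⟩)
    exact ((isLeftAdj _ _).fullyFaithfulι.homEquiv).bijective
  refine { faithful := ⟨fun {f g} η θ h => ?_⟩, full := ⟨fun {f g} β => ?_⟩,
           essSurj := ⟨fun G => ?_⟩ }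
  · exact (key f g).1 (congrArg (fun x => InducedCategory.Hom.hom (Quiver.Hom.unop
      (V := (isRightAdj (F.obj b).schema (F.obj a).schema).FullSubcategory) x)) h)
  · let β' : (⟨r.right g, (r.adj g).adj.isRightAdjoint⟩ :
        (isRightAdj (F.obj b).schema (F.obj a).schema).FullSubcategory) ⟶
        ⟨r.right f, (r.adj f).adj.isRightAdjoint⟩ := Quiver.Hom.unop
      (V := (isRightAdj (F.obj b).schema (F.obj a).schema).FullSubcategory) β
    obtain ⟨η, hη⟩ := (key f g).2 β'.hom
    exact ⟨η, congrArg coopHom hη⟩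
  · obtain ⟨L, ⟨t⟩⟩ := exists_leftTypeAdjunction G.unop.obj G.unop.property
    let L' : F.obj a ⟶ F.obj b := ⟨L, t.adj.isLeftAdjoint⟩
    let e : (F.map ((F.mapFunctor a b).objPreimage L')).obj ≅ L :=
      (isLeftAdj _ _).ι.mapIso ((F.mapFunctor a b).objObjPreimageIso L')
    exact ⟨(F.mapFunctor a b).objPreimage L', ⟨coopIso ((r.adj _).mateIso t e)⟩⟩

end RightAdjoints

lemma isLocalEquivalence_id {B : Type*} [Bicategory B] :
    IsLocalEquivalence (Pseudofunctor.id B) := fun a b =>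
  inferInstanceAs (𝟭 (a ⟶ b)).IsEquivalence

/-- The right adjoints of a choice, for all type-preserving left adjoints. -/
def RightAdjointChoice.rightAdjoints (c : RightAdjointChoice T) :
    RightAdjoints (Pseudofunctor.id (LAdjType T)) where
  right L := c.right L.obj L.property
  adj L := c.adj L.obj L.property
  map₂ η := (c.adj _ _).mate (c.adj _ _) η.hom
  map₂_eq _ := rfl

variable [HasFiniteProducts T]

/-- At an element `x` of `I`, naturality of `lambdaMap φ` along the map named by `x` moves it to a
representable, where the unit turns it into `φ`. -/
lemma nerveMap_lambdaMap {R S : Schema T} {M N : Bimodule R S} (φ : M ⟶ N) (I : Inst R)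
    (J : Inst S) (g : (lambda N).functor.obj I ⟶ J) :
    nerveMap (lambda M).functor (lambdaUnit M).hom I J ((lambdaMap φ).nat.app I ≫ g) =
      nerveMap (lambda N).functor (lambdaUnit N).hom I J g ≫ (nervePre φ).app J := by
  ext r x
  have h := (lambdaMap φ).nat.naturality_assoc (yonEquiv.symm x) g
  have h' := lambdaMap_fac_assoc φ (op r) ((lambda N).functor.map (yonEquiv.symm x) ≫ g)
  exact (congrArg (fun y => _ ≫ y) h).trans h'

/-- The mate of `lambdaMap φ` is characterised by the fact that transposition turns precomposition
with `lambdaMap φ` into postcomposition with the mate; by `nerveMap_lambdaMap`, `gammaMap φ` has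
this property. -/
lemma gammaMap_eq_mate {R S : Schema T} {M N : Bimodule R S} (φ : M ⟶ N) :
    gammaMap φ = (lambdaGamma M).mate (lambdaGamma N) (lambdaMap φ) := by
  have key : ∀ (I : Inst R) (J : Inst S) (g : (lambda N).functor.obj I ⟶ J),
      lambdaHomEquiv M I J ((lambdaMap φ).nat.app I ≫ g) =
        lambdaHomEquiv N I J g ≫ (gammaMap φ).nat.app J := by
    intro I J g
    apply ObjectProperty.hom_ext
    rw [lambdaHomEquiv_hom, nerveMap_lambdaMap]
    change _ = (nerveMap (lambda N).functor (lambdaUnit N).hom I J g ≫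
      (gammaFunctorIso N).inv.app J) ≫ (gammaFunctorIso N).hom.app J ≫ (nervePre φ).app J ≫
        (gammaFunctorIso M).inv.app J
    simp
  refine SliceHom.hom_ext (NatTrans.ext (funext fun J => ?_))
  -- The transpose of the counit is the identity, so `key` at `g` expresses the component of
  -- `gammaMap φ` alone.
  let g : (lambda N).functor.obj ((gamma N).functor.obj J) ⟶ J := (lambdaAdj N).counit.app J
  have h1 : lambdaHomEquiv N _ J g = 𝟙 _ := by
    have h : lambdaHomEquiv N ((gamma N).functor.obj J) J = (lambdaAdj N).homEquiv _ _ := by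
      rw [lambdaAdj, Adjunction.mkOfHomEquiv_homEquiv]
    rw [h, ← Equiv.eq_symm_apply, Adjunction.homEquiv_counit, CategoryTheory.Functor.map_id,
      Category.id_comp]
  have h2 := key _ J g
  rw [h1, Category.id_comp] at h2
  rw [← h2]
  have h3 : lambdaHomEquiv M ((gamma N).functor.obj J) J = (lambdaAdj M).homEquiv _ _ := by
    rw [lambdaAdj, Adjunction.mkOfHomEquiv_homEquiv]
  rw [h3]
  apply ((lambdaAdj M).homEquiv _ _).symm.injective
  rw [Equiv.symm_apply_apply, Adjunction.homEquiv_counit]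
  exact (conjugateEquiv_counit (lambdaAdj N) (lambdaAdj M) (lambdaMap φ).nat J).symm

/-- The right adjoints `Γ_M` of the functors `Λ_M`. -/
noncomputable def gammaRightAdjoints (T : Type u) [SmallCategory T] [HasFiniteProducts T] :
    RightAdjoints (lambdaPseudofunctor T) where
  right {R S} M := gamma (R := R.schema) (S := S.schema) M
  adj {R S} M := lambdaGamma (R := R.schema) (S := S.schema) M
  map₂ {R S _ _} φ := gammaMap (R := R.schema) (S := S.schema) φ
  map₂_eq {R S _ _} φ := gammaMap_eq_mate (R := R.schema) (S := S.schema) φ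

/-- Full faithfulness is `lambdaMap_bijective`; a left adjoint `L` is reached, up to isomorphism,
from the bimodule `restrictYon L`. -/
lemma isLocalEquivalence_lambdaPseudofunctor :
    IsLocalEquivalence (lambdaPseudofunctor T) := by
  intro R S
  refine { faithful := ⟨fun {M N} φ ψ h => ?_⟩, full := ⟨fun {M N} β => ?_⟩,
           essSurj := ⟨fun L => ?_⟩ }
  · have h' : lambdaMap (R := R.schema) (S := S.schema) φ = lambdaMap ψ :=
      congrArg (fun x : (lambdaPseudofunctor T).map M ⟶ (lambdaPseudofunctor T).map N =>
        InducedCategory.Hom.hom x) h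
    exact (lambdaMap_bijective (R := R.schema) (S := S.schema) M N).1 h'
  · obtain ⟨φ, hφ⟩ := (lambdaMap_bijective (R := R.schema) (S := S.schema) M N).2 β.hom
    exact ⟨φ, ObjectProperty.hom_ext _ hφ⟩
  · exact ⟨restrictYon L.obj, ⟨ObjectProperty.isoMk (isLeftAdj R.schema S.schema)
      (lambdaRestrictYonIso L.obj L.property)⟩⟩

end AlgDB

theorem mainTheorem8 (T : Type u) [SmallCategory T] [HasFiniteProducts T] :
    ∃ (Λ : Pseudofunctor (AlgDB.HorData T) (AlgDB.LAdjType T))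
      (Γ : Pseudofunctor (AlgDB.HorData T) (AlgDB.Coop (AlgDB.RAdjType T))),
      AlgDB.dataOf Λ = AlgDB.lambdaData T ∧ AlgDB.dataOf Γ = AlgDB.gammaData T ∧
      AlgDB.IsLocalEquivalence Λ ∧ AlgDB.IsLocalEquivalence Γ ∧
      Nonempty (AlgDB.RightAdjointChoice T) ∧
      ∀ c : AlgDB.RightAdjointChoice T,
        ∃ Ψ : Pseudofunctor (AlgDB.LAdjType T) (AlgDB.Coop (AlgDB.RAdjType T)),
          AlgDB.dataOf Ψ = c.data ∧ AlgDB.IsBiequivalence Ψ ∧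
          ∃ (h : ∀ S, (Λ.comp Ψ).obj S = Γ.obj S) (σ : Pseudofunctor.StrongTrans (Λ.comp Ψ) Γ),
            ∀ S, σ.app S = eqToHom (h S) := by
  -- The pseudofunctors have the prescribed data by definition. For `Ψ`, every target object is the
  -- image of the object on the same schema, so local equivalence suffices; the components of
  -- `compTrans` are identities by construction.
  refine ⟨AlgDB.lambdaPseudofunctor T, (AlgDB.gammaRightAdjoints T).pseudofunctor, rfl, rfl,
    AlgDB.isLocalEquivalence_lambdaPseudofunctor,
    (AlgDB.gammaRightAdjoints T).isLocalEquivalence AlgDB.isLocalEquivalence_lambdaPseudofunctor,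
    AlgDB.nonempty_rightAdjointChoice, fun c => ⟨c.rightAdjoints.pseudofunctor, rfl,
      ⟨c.rightAdjoints.isLocalEquivalence AlgDB.isLocalEquivalence_id, fun S =>
        ⟨⟨S.unop.schema⟩, ⟨Bicategory.Equivalence.id S⟩⟩⟩, fun _ => rfl,
      c.rightAdjoints.compTrans (AlgDB.gammaRightAdjoints T), fun _ => rfl⟩⟩
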